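/- Let $0\le k\le d$ and $n\ge 0$ be integers, and let $\gamma\in\wedge^{k+1}\mathbb C^{d+1}\otimes M_n(\mathbb C)$. For $\mu\in\mathbb C^{d+1}$ regard $\gamma\wedge\mu$ as a linear map $\mathbb C^n\to\wedge^{k+2}\mathbb C^{d+1}\otimes\mathbb C^n$, and put $$D(\gamma)=\{\mu\in\mathbb P^d \mid (\gamma\wedge\mu)v=0 \text{ for some } v\in\mathbb C^n\setminus\{0\}\},$$ a Zariski closed subset of $\mathbb P^d$. Assume that $\gamma$ is non-degenerate: there are linearly independent $v_0,\dots,v_{d-k-1}\in\mathbb C^{d+1}$ such that $\gamma\wedge v_0\wedge\dots\wedge v_{d-k-1}=(e_0\wedge\dots\wedge e_d)\otimes A$ with $A\in M_n(\mathbb C)$ invertible, where $e_0,\dots,e_d$ is the standard basis of $\mathbb C^{d+1}$. For an irreducible component $D_j$ of $D(\gamma)$ let $n_j$ be the dimension of the generic fiber of the kernel sheaf $\mathcal K=\ker\bigl(\gamma\wedge\mu:\mathcal O_{D_j}(-1)^n\to\wedge^{k+2}\mathbb C^{d+1}\otimes\mathcal O_{D_j}^n\bigr)$, and define $$\deg(\gamma)=\sum_{\dim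 D_j=k} n_j\,\deg D_j ,$$ the sum over the $k$-dimensional irreducible components of $D(\gamma)$, where $\deg D_j$ is the degree of $D_j$ as a projective variety in $\mathbb P^d$ ($k!$ times the coefficient of $m^k$ in its Hilbert polynomial). Then: 1. $\deg(\gamma)\le n$. 2. If $\deg(\gamma)=n$ (that is, if $\gamma$ is very reasonable), then $D(\gamma)$ has pure dimension $k$: every irreducible component of $D(\gamma)$ has dimension $k$. -/

import Mathlib

open Filter Topology
open scoped TensorProduct

noncomputable section

namespace Livsic

/-! ### Projective space with its Zariski topology -/

/-- The set of points of complex projective space of dimension `d`. A type synonym, so that it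
carries the Zariski topology below and no other. -/
def PP (d : ℕ) : Type := Projectivization ℂ (Fin (d + 1) → ℂ)

/-- The common zeros in projective space of a set of homogeneous polynomials. (Whether a
homogeneous polynomial vanishes at a point does not depend on the representative.) -/
def projZeros {d : ℕ} (T : Set (MvPolynomial (Fin (d + 1)) ℂ)) : Set (PP d) :=
  {p | ∀ f ∈ T, MvPolynomial.eval (Projectivization.rep p) f = 0}

/-- Projective algebraic sets: common zeros of sets of homogeneous polynomials. -/
def IsProjAlgebraic {d : ℕ} (X : Set (PP d)) : Prop :=
  ∃ T : Set (MvPolynomial (Fin (d + 1)) ℂ), (∀ f ∈ T, ∃ m, f.IsHomogeneous m) ∧ X = projZeros T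

/-- The Zariski topology: the closed sets are the projective algebraic sets. -/
instance zariski (d : ℕ) : TopologicalSpace (PP d) :=
  TopologicalSpace.ofClosed {X | IsProjAlgebraic X}
    (by
      refine ⟨{1}, ?_, ?_⟩
      · rintro f rfl
        exact ⟨0, MvPolynomial.isHomogeneous_one _ _⟩
      · ext p
        simp [projZeros])
    (by
      intro A hA
      refine ⟨{f | ∃ T : Set (MvPolynomial (Fin (d + 1)) ℂ),
        (∀ g ∈ T, ∃ m, g.IsHomogeneous m) ∧ projZeros T ∈ A ∧ f ∈ T}, ?_, ?_⟩
      · rintro f ⟨T, hT, -, hf⟩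
        exact hT f hf
      · ext p
        constructor
        · rintro hp f ⟨T, -, hTA, hf⟩
          exact hp _ hTA f hf
        · intro hp X hX
          obtain ⟨T, hT, rfl⟩ := hA hX
          exact fun f hf => hp f ⟨T, hT, hX, hf⟩)
    (by
      rintro _ ⟨T, hT, rfl⟩ _ ⟨T', hT', rfl⟩
      refine ⟨{h | ∃ f ∈ T, ∃ g ∈ T', h = f * g}, ?_, ?_⟩
      · rintro _ ⟨f, hf, g, hg, rfl⟩
        obtain ⟨a, ha⟩ := hT f hf
        obtain ⟨b, hb⟩ := hT' g hg
        exact ⟨a + b, ha.mul hb⟩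
      · ext p
        constructor
        · rintro (hp | hp) _ ⟨f, hf, g, hg, rfl⟩
          · simp [hp f hf]
          · simp [hp g hg]
        · intro hp
          by_contra hcon
          simp only [Set.mem_union, not_or] at hcon
          obtain ⟨h1, h2⟩ := hcon
          simp only [projZeros, Set.mem_ofPred_eq, not_forall] at h1 h2
          obtain ⟨f, hf, hf0⟩ := h1
          obtain ⟨g, hg, hg0⟩ := h2
          have h3 := hp (f * g) ⟨f, hf, g, hg, rfl⟩
          rw [map_mul] at h3
          exact (mul_ne_zero hf0 hg0) h3)

theorem isClosed_iff {d : ℕ} (X : Set (PP d)) : IsClosed X ↔ IsProjAlgebraic X := by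
  rw [← isOpen_compl_iff]
  change Xᶜᶜ ∈ {X | IsProjAlgebraic X} ↔ _
  rw [compl_compl]
  rfl

/-- The irreducible components of a subset of projective space (with the induced topology),
as subsets of projective space. -/
def components {d : ℕ} (X : Set (PP d)) : Set (Set (PP d)) :=
  (fun s : Set X => Subtype.val '' s) '' irreducibleComponents X

/-- The dimension of a subset of projective space: its Krull dimension for the Zariski topology
(the empty set has dimension `⊥`). -/
def dim {d : ℕ} (X : Set (PP d)) : WithBot ℕ∞ := topologicalKrullDim X

/-- `X` has pure dimension `k`: all its irreducible components have dimension `k`. -/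
def HasPureDim {d : ℕ} (X : Set (PP d)) (k : ℕ) : Prop :=
  ∀ Z ∈ components X, dim Z = k

/-- The homogeneous ideal of a subset of projective space: the ideal of the affine cone
over it. -/
def homIdeal {d : ℕ} (X : Set (PP d)) : Ideal (MvPolynomial (Fin (d + 1)) ℂ) :=
  MvPolynomial.vanishingIdeal ℂ {x : Fin (d + 1) → ℂ | ∃ p ∈ X, x ∈ Projectivization.submodule p}

/-- The homogeneous coordinate ring. -/
abbrev CoordRing {d : ℕ} (X : Set (PP d)) : Type :=
  MvPolynomial (Fin (d + 1)) ℂ ⧸ homIdeal X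

/-- The Hilbert function of `X`: the dimension of the degree `m` part of the homogeneous
coordinate ring. -/
def hilbertFun {d : ℕ} (X : Set (PP d)) (m : ℕ) : ℕ :=
  Module.finrank ℂ ((MvPolynomial.homogeneousSubmodule (Fin (d + 1)) ℂ m).map
    (Ideal.Quotient.mkₐ ℂ (homIdeal X)).toLinearMap)

/-- The degree of a projective variety `X` of dimension `k`: `k!` times the coefficient of `m ^ k`
in the Hilbert polynomial of `X`, that is, the limit of `k! * h_X(m) / m ^ k`. -/
def varDegree {d : ℕ} (k : ℕ) (X : Set (PP d)) : ℝ :=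
  limUnder atTop (fun m : ℕ => (k.factorial : ℝ) * hilbertFun X m / (m : ℝ) ^ k)

/-! ### Tensors -/

/-- The space `∧^{k+1} ℂ^{d+1} ⊗ M_n(ℂ)`. -/
abbrev Tensor (d k n : ℕ) : Type :=
  (⋀[ℂ]^(k + 1) (Fin (d + 1) → ℂ)) ⊗[ℂ] Matrix (Fin n) (Fin n) ℂ

/-- The exterior algebra of `ℂ^{d+1}`. -/
abbrev Ext (d : ℕ) : Type := ExteriorAlgebra ℂ (Fin (d + 1) → ℂ)

/-- `γ ∧ ω`, for `ω` in the exterior algebra: `(η ⊗ A) ∧ ω = (η ∧ ω) ⊗ A`. -/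
def wedge {d k n : ℕ} (γ : Tensor d k n) (ω : Ext d) : Ext d ⊗[ℂ] Matrix (Fin n) (Fin n) ℂ :=
  LinearMap.rTensor (Matrix (Fin n) (Fin n) ℂ)
    ((LinearMap.mulRight ℂ ω).comp (⋀[ℂ]^(k + 1) (Fin (d + 1) → ℂ)).subtype) γ

@[simp]
theorem wedge_tmul {d k n : ℕ} (η : ⋀[ℂ]^(k + 1) (Fin (d + 1) → ℂ))
    (A : Matrix (Fin n) (Fin n) ℂ) (ω : Ext d) :
    wedge (η ⊗ₜ[ℂ] A) ω = ((η : Ext d) * ω) ⊗ₜ[ℂ] A := rfl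

/-- An element of `∧ℂ^{d+1} ⊗ M_n(ℂ)` as a linear map `ℂ^n → ∧ℂ^{d+1} ⊗ ℂ^n`. -/
def toMap {d n : ℕ} (T : Ext d ⊗[ℂ] Matrix (Fin n) (Fin n) ℂ) :
    (Fin n → ℂ) →ₗ[ℂ] Ext d ⊗[ℂ] (Fin n → ℂ) :=
  ((LinearMap.lTensorHom (Ext d)).comp (Matrix.mulVecBilin ℂ ℂ).flip).flip T

@[simp]
theorem toMap_tmul {d n : ℕ} (η : Ext d) (A : Matrix (Fin n) (Fin n) ℂ) (v : Fin n → ℂ) :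
    toMap (η ⊗ₜ[ℂ] A) v = η ⊗ₜ[ℂ] (A.mulVec v) := rfl

/-- `γ` is non-degenerate: there are linearly independent vectors `v_0, …, v_{d-k-1}` such that
`γ ∧ v_0 ∧ ⋯ ∧ v_{d-k-1} = (e_0 ∧ ⋯ ∧ e_d) ⊗ A` with an invertible matrix `A`.
(Meant for `k ≤ d`.) -/
def IsNondegenerate {d k n : ℕ} (γ : Tensor d k n) : Prop :=
  ∃ v : Fin (d - k) → (Fin (d + 1) → ℂ), LinearIndependent ℂ v ∧
    ∃ A : Matrix (Fin n) (Fin n) ℂ, IsUnit A ∧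
      wedge γ (ExteriorAlgebra.ιMulti ℂ (d - k) v) =
        ExteriorAlgebra.ιMulti ℂ (d + 1) (fun i => (Pi.single i 1 : Fin (d + 1) → ℂ)) ⊗ₜ[ℂ] A

/-- `D(γ)`: the points `μ` with `(γ ∧ μ) v = 0` for some nonzero `v`. (The condition does not
depend on the representative of the point.) -/
def locus {d k n : ℕ} (γ : Tensor d k n) : Set (PP d) :=
  {p | ∃ v : Fin n → ℂ, v ≠ 0 ∧
    toMap (wedge γ (ExteriorAlgebra.ι ℂ (Projectivization.rep p))) v = 0}

/-- The map `γ ∧ x` over the homogeneous coordinate ring `B` of `X`, where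
`x = ∑ x_j e_j` is the tautological vector of coordinate functions: a `B`-linear map
`B ⊗ ℂ^n → B ⊗ (∧ℂ^{d+1} ⊗ ℂ^n)`. -/
def coordWedge {d k n : ℕ} (γ : Tensor d k n) (X : Set (PP d)) :
    CoordRing X ⊗[ℂ] (Fin n → ℂ) →ₗ[CoordRing X] CoordRing X ⊗[ℂ] (Ext d ⊗[ℂ] (Fin n → ℂ)) :=
  ∑ j : Fin (d + 1), (Ideal.Quotient.mk (homIdeal X) (MvPolynomial.X j) : CoordRing X) •
    (toMap (wedge γ (ExteriorAlgebra.ι ℂ (Pi.single j 1)))).baseChange (CoordRing X)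

/-- The multiplicity of an irreducible component `X` of `D(γ)`: the dimension of the generic fiber
of the kernel sheaf of `γ ∧ μ` on `X`. The kernel sheaf is the sheaf of the graded module
`ker (γ ∧ x)` over the homogeneous coordinate ring of `X`; the fraction field of that ring extends
the function field of `X`, and the dimension may be computed over it. -/
def genericKernelDim {d k n : ℕ} (γ : Tensor d k n) (X : Set (PP d)) : ℕ :=
  Module.finrank (FractionRing (CoordRing X))
    (FractionRing (CoordRing X) ⊗[CoordRing X] LinearMap.ker (coordWedge γ X))

/-- The degree of `γ`, that is, of the `k`-dimensional part of the cycle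
`Z(γ) = ∑ n_j [D_j]`: the sum of `n_j * deg D_j` over the irreducible components `D_j` of
dimension `k` of `D(γ)`. -/
def degree {d k n : ℕ} (γ : Tensor d k n) : ℝ :=
  ∑ᶠ Z ∈ {Z ∈ components (locus γ) | dim Z = k}, (genericKernelDim γ Z : ℝ) * varDegree k Z

/-- `γ` is very reasonable. -/
def IsVeryReasonable {d k n : ℕ} (γ : Tensor d k n) : Prop :=
  degree γ = n

end Livsic

end

noncomputable section

namespace Livsic

/-! ### Contractions of tensors -/

/-! Put `S = ℂ[y_0, …, y_k]`. Complete the vectors `v_i` of non-degeneracy to a basis, and let `w_i`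
and `y_l` be the coordinates of `x` along the `v_i` and along the added vectors. Wedging `(γ ∧ x) z
= 0` with the remaining `v`'s and reading off the volume coefficient gives `w_i z = -∑ y_l B_{il} z`
with constant matrices `B_{il}`. So on solutions `z` each coordinate `x_j` acts as a matrix `X_j`
over `S`, linear in the `y_l` (`exists_actsByCoordinates`), and every polynomial `f` acts as some
matrix `F` over `S` (`exists_represents`).

Let `Z` be a `k`-dimensional component with coordinate ring `R`. The characteristic polynomials of
the `X_j` make `R` finite over `S`; since `dim R ≥ k + 1`, `S` embeds in `R`, and Hilbert functions
identify `deg Z` with the rank `r` of `R` over `S`. The generic kernel supplies `n_Z` solutions in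
`R^n` independent over `R`, hence `r * n_Z` independent over `S`. An `S`-linear `φ : R → S` that
kills no nonzero ideal carries them to independent vectors of `S^n`, with `F φ(z) = φ(f z)`
(`exists_family_of_quotient`).

Polynomials vanishing on all chosen components but one show that the families of different
components are jointly independent in `S^n`, whence `deg γ ≤ n`. If equality holds and some
component `Z'` were left out, take `f` vanishing on the chosen components but not on `Z'`: then `F`
kills `n` independent vectors, so `F = 0`, although `F` multiplies the kernel vectors over points of
`Z'` by the values of `f` (`sum_le_and_mem_of_sum_eq`). -/

theorem exists_ιMulti_update {d m : ℕ} (v : Fin m → Fin (d + 1) → ℂ) (i : Fin m) :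
    ∃ ω : Ext d, ∀ μ, ExteriorAlgebra.ιMulti ℂ m (Function.update v i μ) =
      ExteriorAlgebra.ι ℂ μ * ω := by
  cases m with
  | zero => exact i.elim0
  | succ m =>
    by_cases hi : i = 0
    · subst hi
      refine ⟨ExteriorAlgebra.ιMulti ℂ m (Matrix.vecTail v), fun μ => ?_⟩
      rw [ExteriorAlgebra.ιMulti_succ_apply]
      congr 2
    · refine ⟨-ExteriorAlgebra.ιMulti ℂ m (Matrix.vecTail (Function.update v i (v 0))),
        fun μ => ?_⟩
      -- Swapping slots `0` and `i` brings `μ` to the front, at the price of the sign built into the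
      -- witness.
      rw [← neg_eq_iff_eq_neg.mpr (AlternatingMap.map_swap (ExteriorAlgebra.ιMulti ℂ (m + 1))
        (Function.update v i μ) (Ne.symm hi)), ExteriorAlgebra.ιMulti_succ_apply, mul_neg]
      congr 3
      · simp
      · ext a j
        by_cases ha : a.succ = i
        · simp [Matrix.vecTail, ha, Function.update_of_ne (Ne.symm hi)]
        · simp [Matrix.vecTail, Equiv.swap_apply_def, ha, Fin.succ_ne_zero]

/-- A linear functional on the exterior algebra that takes the value `1` at the volume element. -/
def volForm (d : ℕ) : Ext d →ₗ[ℂ] ℂ :=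
  ExteriorAlgebra.liftAlternating
    (Function.update (β := fun i => (Fin (d + 1) → ℂ) [⋀^Fin i]→ₗ[ℂ] ℂ) 0 (d + 1)
      Matrix.detRowAlternating)

theorem volForm_ιMulti_single (d : ℕ) :
    volForm d (ExteriorAlgebra.ιMulti ℂ (d + 1)
      (fun i => (Pi.single i 1 : Fin (d + 1) → ℂ))) = 1 := by
  rw [volForm, ExteriorAlgebra.liftAlternating_apply_ιMulti, Function.update_self]
  have : (fun i => (Pi.single i 1 : Fin (d + 1) → ℂ)) = (1 : Matrix _ _ ℂ) := by
    ext i j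
    simp [Matrix.one_apply, Pi.single_apply, eq_comm]
  rw [this]
  exact Matrix.det_one

/-- Contraction of the first factor of a tensor by a linear functional. -/
def contract {d : ℕ} (M : Type) [AddCommGroup M] [Module ℂ M] (φ : Ext d →ₗ[ℂ] ℂ) :
    Ext d ⊗[ℂ] M →ₗ[ℂ] M :=
  (TensorProduct.lid ℂ M).toLinearMap ∘ₗ LinearMap.rTensor M φ

@[simp]
theorem contract_tmul {d : ℕ} {M : Type} [AddCommGroup M] [Module ℂ M] (φ : Ext d →ₗ[ℂ] ℂ)
    (η : Ext d) (m : M) : contract M φ (η ⊗ₜ m) = φ η • m := by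
  simp [contract]

theorem contract_mulVec {d n : ℕ} (φ : Ext d →ₗ[ℂ] ℂ)
    (T : Ext d ⊗[ℂ] Matrix (Fin n) (Fin n) ℂ) (v : Fin n → ℂ) :
    (contract _ φ T).mulVec v = contract _ φ (toMap T v) := by
  induction T with
  | zero => simp [toMap]
  | tmul η A => simp [Matrix.smul_mulVec]
  | add a b ha hb =>
    have : toMap (a + b) v = toMap a v + toMap b v := by simp [toMap]
    rw [map_add, Matrix.add_mulVec, ha, hb, this, map_add]

/-- The matrix `φ (γ ∧ ω)`. -/
def coeffMatrix {d k n : ℕ} (γ : Tensor d k n) (φ : Ext d →ₗ[ℂ] ℂ) :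
    Ext d →ₗ[ℂ] Matrix (Fin n) (Fin n) ℂ where
  toFun ω := contract _ φ (wedge γ ω)
  map_add' ω ω' := by
    rw [← map_add]
    congr 1
    induction γ using TensorProduct.induction_on with
    | zero => simp [wedge]
    | tmul η A => simp [mul_add, TensorProduct.add_tmul]
    | add a b ha hb =>
      simp only [wedge, map_add] at ha hb ⊢
      rw [ha, hb]
      abel
  map_smul' c ω := by
    rw [RingHom.id_apply, ← map_smul]
    congr 1
    induction γ using TensorProduct.induction_on with
    | zero => simp [wedge]
    | tmul η A => simp [TensorProduct.smul_tmul']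
    | add a b ha hb =>
      simp only [wedge, map_add, smul_add] at ha hb ⊢
      rw [ha, hb]

theorem wedge_mul {d k n : ℕ} (γ : Tensor d k n) (η ω : Ext d) :
    wedge γ (η * ω) = LinearMap.rTensor _ (LinearMap.mulRight ℂ ω) (wedge γ η) := by
  induction γ using TensorProduct.induction_on with
  | zero => simp [wedge]
  | tmul η A => simp [mul_assoc]
  | add a b ha hb =>
    simp only [wedge, map_add] at ha hb ⊢
    rw [ha, hb]

theorem coeffMatrix_mul_mulVec {d k n : ℕ} (γ : Tensor d k n) (φ : Ext d →ₗ[ℂ] ℂ) (η ω : Ext d)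
    (v : Fin n → ℂ) :
    (coeffMatrix γ φ (η * ω)).mulVec v =
      contract _ (φ ∘ₗ LinearMap.mulRight ℂ ω) (toMap (wedge γ η) v) := by
  rw [← contract_mulVec]
  congr 1
  change contract _ φ (wedge γ (η * ω)) = _
  rw [wedge_mul]
  simp [contract, LinearMap.rTensor_comp]

/-! ### Polynomials acting on solutions through matrices -/

/-- `z` is a solution of `(γ ∧ x) z = 0` for a vector `x` with entries in a `ℂ`-algebra,
tested against functionals. -/
def Annihilates {d k n : ℕ} (γ : Tensor d k n) {R : Type} [CommRing R] [Algebra ℂ R]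
    (x : Fin (d + 1) → R) (z : Fin n → R) : Prop :=
  ∀ (φ : Ext d →ₗ[ℂ] ℂ) (ω : Ext d), ∑ j, x j •
    ((coeffMatrix γ φ (ExteriorAlgebra.ι ℂ (Pi.single j 1) * ω)).map (algebraMap ℂ R)).mulVec z = 0

/-- The matrices `X j` act on the solutions `z` of `(γ ∧ x) z = 0` as the coordinates `x j`. -/
def ActsByCoordinates {d k n : ℕ} (γ : Tensor d k n)
    (ℓ : Fin (k + 1) → MvPolynomial (Fin (d + 1)) ℂ)
    (X : Fin (d + 1) → Matrix (Fin n) (Fin n) (MvPolynomial (Fin (k + 1)) ℂ)) : Prop :=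
  ∀ (R : Type) [CommRing R] [Algebra ℂ R] (x : Fin (d + 1) → R) (z : Fin n → R),
    Annihilates γ x z → ∀ j,
      ((X j).map (MvPolynomial.aeval fun l => MvPolynomial.aeval x (ℓ l))).mulVec z = x j • z

theorem exists_basis_extending {d k : ℕ} (hk : k ≤ d) {v : Fin (d - k) → Fin (d + 1) → ℂ}
    (hv : LinearIndependent ℂ v) :
    ∃ b : Module.Basis (Fin (d - k) ⊕ Fin (k + 1)) ℂ (Fin (d + 1) → ℂ), ∀ i, b (.inl i) = v i := by
  classical
  let b := Module.Basis.sumExtend hv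
  have : Finite (Fin (d - k) ⊕ Module.Basis.sumExtendIndex hv) := Module.Finite.finite_basis b
  have : Finite (Module.Basis.sumExtendIndex hv) := Finite.sum_right (Fin (d - k))
  have : Fintype (Module.Basis.sumExtendIndex hv) := Fintype.ofFinite _
  have h := Module.finrank_eq_card_basis b
  rw [Module.finrank_fin_fun, Fintype.card_sum, Fintype.card_fin] at h
  let e : Module.Basis.sumExtendIndex hv ≃ Fin (k + 1) :=
    Fintype.equivFinOfCardEq (by omega)
  refine ⟨b.reindex (Equiv.sumCongr (Equiv.refl _) e), fun i => ?_⟩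
  simp [b, Module.Basis.sumExtend]
  rfl

/-- Non-degeneracy lets the coordinates `w i` along the `v i` be eliminated: on a solution they act
as linear combinations of the remaining coordinates `y l` with matrix coefficients. Quantifying over
all algebras `R` allows use both at points (`R = ℂ`) and over coordinate rings. -/
theorem exists_actsByCoordinates {d k n : ℕ} (hk : k ≤ d) {γ : Tensor d k n}
    (hγ : IsNondegenerate γ) :
    ∃ (ℓ : Fin (k + 1) → MvPolynomial (Fin (d + 1)) ℂ)
      (X : Fin (d + 1) → Matrix (Fin n) (Fin n) (MvPolynomial (Fin (k + 1)) ℂ)),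
      (∀ l, (ℓ l).IsHomogeneous 1) ∧ ActsByCoordinates γ ℓ X := by
  obtain ⟨v, hv, A, hA, hvA⟩ := hγ
  obtain ⟨b, hb⟩ := exists_basis_extending hk hv
  choose ω hω using exists_ιMulti_update v
  let Γ : Fin (d - k) → (Fin (d + 1) → ℂ) →ₗ[ℂ] Matrix (Fin n) (Fin n) ℂ := fun i =>
    coeffMatrix γ (volForm d) ∘ₗ LinearMap.mulRight ℂ (ω i) ∘ₗ ExteriorAlgebra.ι ℂ
  -- Putting `v i'` in slot `i` restores the original wedge if `i' = i` and repeats a vector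
  -- otherwise.
  have hΓ : ∀ i i', Γ i (v i') = if i' = i then A else 0 := by
    intro i i'
    have h1 : Γ i (v i') = contract _ (volForm d)
        (wedge γ (ExteriorAlgebra.ιMulti ℂ (d - k) (Function.update v i (v i')))) := by
      rw [hω]; rfl
    rw [h1]
    split_ifs with h
    · subst h
      rw [Function.update_eq_self, hvA, contract_tmul, volForm_ιMulti_single, one_smul]
    · rw [(ExteriorAlgebra.ιMulti ℂ (d - k)).map_update_self _ (Ne.symm h)]
      have : wedge γ 0 = 0 := by simp [wedge]
      rw [this, map_zero]
  have hAdet : IsUnit A.det := (Matrix.isUnit_iff_isUnit_det A).mp hA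
  let e : Fin (d + 1) → Fin (d + 1) → ℂ := fun j => Pi.single j 1
  obtain ⟨B, hB⟩ : ∃ B : Fin (d - k) → Fin (k + 1) → Matrix (Fin n) (Fin n) ℂ,
      ∀ i l, B i l = A⁻¹ * Γ i (b (.inr l)) := ⟨_, fun _ _ => rfl⟩
  have hΓe : ∀ i j, A⁻¹ * Γ i (e j) = b.repr (e j) (.inl i) • (1 : Matrix (Fin n) (Fin n) ℂ) +
      ∑ l, b.repr (e j) (.inr l) • (B i l) := by
    intro i j
    conv_lhs => rw [← b.sum_repr (e j)]
    rw [map_sum, Fintype.sum_sum_type, mul_add, Finset.mul_sum, Finset.mul_sum]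
    congr 1
    · simp only [map_smul, hb, hΓ]
      simp [Matrix.nonsing_inv_mul A hAdet]
    · simp only [map_smul, mul_smul_comm, hB]
  have hbe : ∀ j' j, (if j' = j then (1 : ℂ) else 0) =
      ∑ i, b.repr (e j') (.inl i) * v i j + ∑ l, b.repr (e j') (.inr l) * b (.inr l) j := by
    intro j' j
    have h := congrFun (b.sum_repr (e j')) j
    rw [Fintype.sum_sum_type] at h
    simp only [hb, Pi.add_apply, Finset.sum_apply, Pi.smul_apply, smul_eq_mul] at h
    rw [h]
    simp [e, Pi.single_apply, eq_comm]
  -- `ℓ l` is the coordinate `y l` of `x`. `X j` comes from `x j = ∑ v i j * w i + ∑ b (.inr l) j *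
  -- y l` on replacing `w i` by `-∑ y l • B i l`.
  refine ⟨fun l => ∑ j, MvPolynomial.C (b.repr (e j) (.inr l)) * MvPolynomial.X j,
    fun j => ∑ l, (MvPolynomial.X l : MvPolynomial (Fin (k + 1)) ℂ) •
      (b (.inr l) j • (1 : Matrix (Fin n) (Fin n) ℂ) -
        ∑ i, v i j • (B i l)).map MvPolynomial.C,
    fun l => MvPolynomial.IsHomogeneous.sum _ _ _ fun j _ =>
      MvPolynomial.isHomogeneous_C_mul_X _ _, ?_⟩
  intro R _ _ x z hz j
  set y : Fin (k + 1) → R := fun l => ∑ j, algebraMap ℂ R (b.repr (e j) (.inr l)) * x j with hy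
  set w : Fin (d - k) → R := fun i => ∑ j, algebraMap ℂ R (b.repr (e j) (.inl i)) * x j with hw
  set N : Fin (d - k) → Fin (k + 1) → (Fin n → R) := fun i l =>
    ((B i l).map (algebraMap ℂ R)).mulVec z with hN
  -- This is the equation tested against `volForm d` and `ω i`, multiplied by `A⁻¹` and expanded in
  -- the basis.
  have key : ∀ i, w i • z + ∑ l, y l • N i l = 0 := by
    intro i
    have h1 : ∑ j, x j • ((Γ i (e j)).map (algebraMap ℂ R)).mulVec z = 0 :=
      hz (volForm d) (ω i)
    have h2 : ∑ j, x j • ((A⁻¹ * Γ i (e j)).map (algebraMap ℂ R)).mulVec z = 0 := by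
      have := congrArg (fun u => (A⁻¹.map (algebraMap ℂ R)).mulVec u) h1
      simpa [Matrix.mulVec_sum, Matrix.mulVec_smul, Matrix.map_mul] using this
    have h3 : ∀ j, ((A⁻¹ * Γ i (e j)).map (algebraMap ℂ R)).mulVec z =
        algebraMap ℂ R (b.repr (e j) (.inl i)) • z +
          ∑ l, algebraMap ℂ R (b.repr (e j) (.inr l)) • N i l := by
      intro j
      have h4 : (A⁻¹ * Γ i (e j)).map (algebraMap ℂ R) =
          algebraMap ℂ R (b.repr (e j) (.inl i)) • (1 : Matrix (Fin n) (Fin n) R) +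
          ∑ l, algebraMap ℂ R (b.repr (e j) (.inr l)) •
            (B i l).map (algebraMap ℂ R) := by
        rw [hΓe]
        ext p q
        by_cases hpq : p = q <;> simp [Matrix.sum_apply, hpq, -algebraMap_smul]
      rw [h4, Matrix.add_mulVec, Matrix.smul_mulVec, Matrix.one_mulVec, Matrix.sum_mulVec]
      simp only [Matrix.smul_mulVec, hN]
    rw [← h2]
    simp only [h3, smul_add, Finset.sum_add_distrib, hw, hy, Finset.sum_smul, Finset.smul_sum,
      smul_smul]
    congr 1
    · simp only [mul_comm]
    · rw [Finset.sum_comm]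
      simp only [mul_comm]
  have hx : x j = ∑ i, algebraMap ℂ R (v i j) * w i + ∑ l, algebraMap ℂ R (b (.inr l) j) * y l := by
    have h1 : x j = ∑ j', algebraMap ℂ R (if j' = j then 1 else 0) * x j' := by
      simp [apply_ite (algebraMap ℂ R)]
    rw [h1]
    simp only [hbe, map_add, map_sum, map_mul, add_mul, Finset.sum_add_distrib, hw, hy,
      Finset.mul_sum, Finset.sum_mul]
    congr 1
    · rw [Finset.sum_comm]
      exact Finset.sum_congr rfl fun _ _ => Finset.sum_congr rfl fun _ _ => by ring
    · rw [Finset.sum_comm]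
      exact Finset.sum_congr rfl fun _ _ => Finset.sum_congr rfl fun _ _ => by ring
  have hX : ((∑ l, (MvPolynomial.X l : MvPolynomial (Fin (k + 1)) ℂ) •
      (b (.inr l) j • (1 : Matrix (Fin n) (Fin n) ℂ) -
        ∑ i, v i j • (B i l)).map MvPolynomial.C).map
      (MvPolynomial.aeval fun l => MvPolynomial.aeval x
        (∑ j, MvPolynomial.C (b.repr (e j) (.inr l)) * MvPolynomial.X j))) =
      ∑ l, y l • (algebraMap ℂ R (b (.inr l) j) • (1 : Matrix (Fin n) (Fin n) R) -
        ∑ i, algebraMap ℂ R (v i j) • (B i l).map (algebraMap ℂ R)) := by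
    ext p q
    simp [Matrix.sum_apply, Matrix.one_apply, hy, apply_ite, -algebraMap_smul]
  rw [hX, hx, Matrix.sum_mulVec]
  simp only [Matrix.smul_mulVec, Matrix.sub_mulVec, Matrix.sum_mulVec, Matrix.one_mulVec, add_smul,
    Finset.sum_smul, smul_sub, Finset.sum_sub_distrib, Finset.smul_sum, mul_smul]
  have h5 : ∀ i, w i • z = - ∑ l, y l • N i l := fun i => eq_neg_of_add_eq_zero_left (key i)
  simp only [h5, smul_neg, Finset.smul_sum, Finset.sum_neg_distrib, hN]
  rw [sub_eq_neg_add]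
  congr 1
  · rw [Finset.sum_comm]
    simp only [smul_comm (y _)]
  · simp only [smul_comm (y _)]

/-- `F` acts on the solutions `z` of `(γ ∧ x) z = 0` as `f x`. -/
def Represents {d k n : ℕ} (γ : Tensor d k n) (ℓ : Fin (k + 1) → MvPolynomial (Fin (d + 1)) ℂ)
    (F : Matrix (Fin n) (Fin n) (MvPolynomial (Fin (k + 1)) ℂ))
    (f : MvPolynomial (Fin (d + 1)) ℂ) : Prop :=
  ∀ (R : Type) [CommRing R] [Algebra ℂ R] (x : Fin (d + 1) → R) (z : Fin n → R),
    Annihilates γ x z → (F.map (MvPolynomial.aeval fun l => MvPolynomial.aeval x (ℓ l))).mulVec z =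
      MvPolynomial.aeval x f • z

/-- The `X j` need not commute: in `P * X j` the right factor already turns `z` into a multiple of
`z`, to which the identity for `P` applies. -/
theorem exists_represents {d k n : ℕ} {γ : Tensor d k n}
    {ℓ : Fin (k + 1) → MvPolynomial (Fin (d + 1)) ℂ}
    {X : Fin (d + 1) → Matrix (Fin n) (Fin n) (MvPolynomial (Fin (k + 1)) ℂ)}
    (hX : ActsByCoordinates γ ℓ X) (f : MvPolynomial (Fin (d + 1)) ℂ) :
    ∃ F, Represents γ ℓ F f := by
  induction f using MvPolynomial.induction_on with
  | C a =>
    refine ⟨(MvPolynomial.C a : MvPolynomial (Fin (k + 1)) ℂ) • 1, fun R _ _ x z _ => ?_⟩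
    have : ((MvPolynomial.C a : MvPolynomial (Fin (k + 1)) ℂ) •
        (1 : Matrix (Fin n) (Fin n) _)).map
        (MvPolynomial.aeval (fun l => MvPolynomial.aeval x (ℓ l)) :
          MvPolynomial (Fin (k + 1)) ℂ →ₐ[ℂ] R) =
          algebraMap ℂ R a • (1 : Matrix (Fin n) (Fin n) R) := by
      ext p q
      by_cases hpq : p = q <;> simp [hpq, -algebraMap_smul]
    rw [this, Matrix.smul_mulVec, Matrix.one_mulVec, MvPolynomial.aeval_C]
  | add p q hp hq =>
    obtain ⟨P, hP⟩ := hp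
    obtain ⟨Q, hQ⟩ := hq
    refine ⟨P + Q, fun R _ _ x z hz => ?_⟩
    rw [Matrix.map_add _ (by simp), Matrix.add_mulVec, hP R x z hz, hQ R x z hz, map_add,
      add_smul]
  | mul_X p j hp =>
    obtain ⟨P, hP⟩ := hp
    refine ⟨P * X j, fun R _ _ x z hz => ?_⟩
    rw [Matrix.map_mul, ← Matrix.mulVec_mulVec, hX R x z hz j, Matrix.mulVec_smul, hP R x z hz,
      map_mul, MvPolynomial.aeval_X, smul_smul, mul_comm]

/-! ### Homogeneous ideals of subsets of projective space -/

theorem eval_smul_of_isHomogeneous {σ : Type*} [Fintype σ] {f : MvPolynomial σ ℂ} {m : ℕ}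
    (hf : f.IsHomogeneous m) (c : ℂ) (x : σ → ℂ) :
    MvPolynomial.eval (c • x) f = c ^ m * MvPolynomial.eval x f := by
  rw [MvPolynomial.eval_eq', MvPolynomial.eval_eq', Finset.mul_sum]
  refine Finset.sum_congr rfl fun s hs => ?_
  have h : ∑ i, s i = m := by
    rw [← Finsupp.degree_eq_sum]
    by_contra h
    exact (MvPolynomial.mem_support_iff.mp hs) (hf.coeff_eq_zero h)
  simp only [Pi.smul_apply, smul_eq_mul, mul_pow, Finset.prod_mul_distrib,
    Finset.prod_pow_eq_pow_sum, h]
  ring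

theorem mem_homIdeal {d : ℕ} {X : Set (PP d)} {f : MvPolynomial (Fin (d + 1)) ℂ} :
    f ∈ homIdeal X ↔ ∀ p ∈ X, ∀ c : ℂ,
      MvPolynomial.eval (c • Projectivization.rep p) f = 0 := by
  rw [homIdeal, MvPolynomial.mem_vanishingIdeal_iff]
  constructor
  · intro h p hp c
    rw [← MvPolynomial.aeval_eq_eval]
    refine h _ ⟨p, hp, ?_⟩
    rw [Projectivization.submodule_eq (K := ℂ) (V := Fin (d + 1) → ℂ) p]
    exact Submodule.smul_mem _ _ (Submodule.mem_span_singleton_self _)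
  · rintro h x ⟨p, hp, hx⟩
    change x ∈ Projectivization.submodule (K := ℂ) (V := Fin (d + 1) → ℂ) p at hx
    rw [Projectivization.submodule_eq (K := ℂ) (V := Fin (d + 1) → ℂ) p] at hx
    obtain ⟨c, rfl⟩ := Submodule.mem_span_singleton.mp hx
    rw [MvPolynomial.aeval_eq_eval]
    exact h p hp c

theorem homIdeal_anti {d : ℕ} {X Y : Set (PP d)} (h : X ⊆ Y) : homIdeal Y ≤ homIdeal X :=
  fun _ hf => mem_homIdeal.mpr fun p hp => mem_homIdeal.mp hf p (h hp)

theorem mem_homIdeal_of_isHomogeneous {d : ℕ} {X : Set (PP d)} {f : MvPolynomial (Fin (d + 1)) ℂ}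
    {m : ℕ} (hf : f.IsHomogeneous m) :
    f ∈ homIdeal X ↔ ∀ p ∈ X, MvPolynomial.eval (Projectivization.rep p) f = 0 := by
  rw [mem_homIdeal]
  refine forall₂_congr fun p _ => ⟨fun h => by simpa using h 1, fun h c => ?_⟩
  rw [eval_smul_of_isHomogeneous hf, h, mul_zero]

attribute [local instance] MvPolynomial.gradedAlgebra

/-- On the line through a representative `x`, `f (c • x)` is a polynomial in `c` whose coefficients
are the values at `x` of the homogeneous components. It vanishes for all `c`, so every coefficient
does. -/
theorem homIdeal_isHomogeneous {d : ℕ} (X : Set (PP d)) :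
    (homIdeal X).IsHomogeneous (MvPolynomial.homogeneousSubmodule (Fin (d + 1)) ℂ) := by
  intro i f hf
  have h1 : (DirectSum.decompose (MvPolynomial.homogeneousSubmodule (Fin (d + 1)) ℂ) f i :
      MvPolynomial (Fin (d + 1)) ℂ) = MvPolynomial.homogeneousComponent i f :=
    MvPolynomial.decomposition.decompose'_apply f i
  rw [h1, mem_homIdeal_of_isHomogeneous (MvPolynomial.homogeneousComponent_isHomogeneous i f)]
  intro p hp
  set x := Projectivization.rep p
  let g : Polynomial ℂ := ∑ j ∈ Finset.range (f.totalDegree + 1),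
    Polynomial.C (MvPolynomial.eval x (MvPolynomial.homogeneousComponent j f)) * Polynomial.X ^ j
  have hg : g = 0 := by
    refine Polynomial.funext fun c => ?_
    have h2 := mem_homIdeal.mp hf p hp c
    rw [← MvPolynomial.sum_homogeneousComponent f, map_sum] at h2
    simp only [g, Polynomial.eval_finsetSum, Polynomial.eval_mul, Polynomial.eval_C,
      Polynomial.eval_pow, Polynomial.eval_X, Polynomial.eval_zero]
    rw [← h2]
    refine Finset.sum_congr rfl fun j _ => ?_
    rw [eval_smul_of_isHomogeneous (MvPolynomial.homogeneousComponent_isHomogeneous j f), mul_comm]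
  by_cases hi : i < f.totalDegree + 1
  · have h3 := congrArg (fun q => Polynomial.coeff q i) hg
    simpa [g, Polynomial.finsetSum_coeff, Polynomial.coeff_C_mul, Polynomial.coeff_X_pow, hi,
      Nat.lt_succ_iff] using h3
  · rw [MvPolynomial.homogeneousComponent_eq_zero _ _ (by omega), map_zero]

theorem homogeneousComponent_mem_homIdeal {d : ℕ} {X : Set (PP d)}
    {f : MvPolynomial (Fin (d + 1)) ℂ} (hf : f ∈ homIdeal X) (i : ℕ) :
    MvPolynomial.homogeneousComponent i f ∈ homIdeal X :=
  MvPolynomial.homogeneousComponent_mem_of_mem (homIdeal_isHomogeneous X) hf i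

theorem exists_isHomogeneous_of_notMem {d : ℕ} {C : Set (PP d)} (hC : IsClosed C) {p : PP d}
    (hp : p ∉ C) : ∃ f ∈ homIdeal C, ∃ m, f.IsHomogeneous m ∧
      MvPolynomial.eval (Projectivization.rep p) f ≠ 0 := by
  obtain ⟨T, hT, rfl⟩ := (isClosed_iff C).mp hC
  simp only [projZeros, Set.mem_ofPred_eq, not_forall] at hp
  obtain ⟨f, hf, hfp⟩ := hp
  obtain ⟨m, hm⟩ := hT f hf
  exact ⟨f, (mem_homIdeal_of_isHomogeneous hm).mpr fun q hq => hq f hf, m, hm, hfp⟩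

theorem isClosed_zeros {d : ℕ} {f : MvPolynomial (Fin (d + 1)) ℂ} {m : ℕ}
    (hf : f.IsHomogeneous m) :
    IsClosed {p : PP d | MvPolynomial.eval (Projectivization.rep p) f = 0} := by
  rw [isClosed_iff]
  exact ⟨{f}, by rintro _ rfl; exact ⟨m, hf⟩, by ext p; simp [projZeros]⟩

theorem homIdeal_isPrime {d : ℕ} {X : Set (PP d)} (hX : IsIrreducible X) :
    (homIdeal X).IsPrime := by
  refine (homIdeal_isHomogeneous X).isPrime_of_homogeneous_mem_or_mem ?_ ?_
  · obtain ⟨p, hp⟩ := hX.nonempty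
    rw [Ideal.ne_top_iff_one, mem_homIdeal]
    intro h
    simpa using h p hp 1
  · rintro f g ⟨a, ha⟩ ⟨b, hb⟩ hfg
    rw [MvPolynomial.mem_homogeneousSubmodule] at ha hb
    rw [mem_homIdeal_of_isHomogeneous (ha.mul hb)] at hfg
    rw [mem_homIdeal_of_isHomogeneous ha, mem_homIdeal_of_isHomogeneous hb]
    refine isPreirreducible_iff_isClosed_union_isClosed.mp hX.isPreirreducible _ _
      (isClosed_zeros ha) (isClosed_zeros hb) fun p hp => ?_
    have := hfg p hp
    rw [map_mul] at this
    exact mul_eq_zero.mp this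

theorem constantCoeff_eq_zero_of_mem_homIdeal {d : ℕ} {X : Set (PP d)} (hX : X.Nonempty)
    {f : MvPolynomial (Fin (d + 1)) ℂ} (hf : f ∈ homIdeal X) :
    MvPolynomial.constantCoeff f = 0 := by
  obtain ⟨p, hp⟩ := hX
  have := mem_homIdeal.mp hf p hp 0
  rwa [zero_smul, MvPolynomial.eval_zero] at this

theorem exists_X_notMem_homIdeal {d : ℕ} {X : Set (PP d)} (hX : X.Nonempty) :
    ∃ j, (MvPolynomial.X j : MvPolynomial (Fin (d + 1)) ℂ) ∉ homIdeal X := by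
  obtain ⟨p, hp⟩ := hX
  by_contra! h
  refine Projectivization.rep_nonzero p (funext fun j => ?_)
  simpa using mem_homIdeal.mp (h j) p hp 1

/-! ### Dimension -/

/-- A chain of irreducible closed subsets of `Z` becomes a reversed chain of homogeneous primes. The
affine cone has one more dimension because the irrelevant ideal, the vertex of the cone, can be
added to the chain. -/
theorem add_one_le_ringKrullDim_coordRing {d k : ℕ} {Z : Set (PP d)} (hZ : dim Z = k) :
    (k + 1 : WithBot ℕ∞) ≤ ringKrullDim (CoordRing Z) := by
  rw [dim, topologicalKrullDim] at hZ
  obtain ⟨l, hl⟩ := Order.le_krullDim_iff.mp hZ.ge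
  have hirr (T : TopologicalSpace.IrreducibleCloseds Z) :
      IsIrreducible (Subtype.val '' (T : Set Z)) :=
    T.isIrreducible.image _ continuous_subtype_val.continuousOn
  let F : TopologicalSpace.IrreducibleCloseds Z →
      (PrimeSpectrum.zeroLocus (homIdeal Z : Set (MvPolynomial (Fin (d + 1)) ℂ)))ᵒᵈ := fun T =>
    OrderDual.toDual ⟨⟨homIdeal (Subtype.val '' (T : Set Z)), homIdeal_isPrime (hirr T)⟩,
      homIdeal_anti (by rintro _ ⟨x, _, rfl⟩; exact x.2)⟩
  have hF : StrictMono F := by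
    intro T T' h
    refine lt_of_le_not_ge (homIdeal_anti (Set.image_mono h.le)) fun h' => ?_
    obtain ⟨-, x, hx', hx⟩ := Set.ssubset_iff_exists.mp (show (T : Set Z) ⊂ T' from h)
    obtain ⟨C, hC, hCT⟩ := isClosed_induced_iff.mp T.isClosed
    have hxC : (x : PP d) ∉ C := fun hx'' => hx (hCT ▸ hx'')
    obtain ⟨f, hf, m, -, hfx⟩ := exists_isHomogeneous_of_notMem hC hxC
    have h1 : f ∈ homIdeal (Subtype.val '' (T : Set Z)) := by
      refine homIdeal_anti ?_ hf
      rintro _ ⟨y, hy, rfl⟩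
      rw [← hCT] at hy
      exact hy
    have h2 := mem_homIdeal.mp (h' h1) x ⟨x, hx', rfl⟩ 1
    exact hfx (by simpa using h2)
  let 𝔪 : PrimeSpectrum (MvPolynomial (Fin (d + 1)) ℂ) :=
    ⟨RingHom.ker (MvPolynomial.constantCoeff), RingHom.ker_isPrime _⟩
  have hm (T : TopologicalSpace.IrreducibleCloseds Z) :
      homIdeal (Subtype.val '' (T : Set Z)) ≤ 𝔪.asIdeal := fun f hf =>
    constantCoeff_eq_zero_of_mem_homIdeal (hirr T).nonempty hf
  let 𝔪' : (PrimeSpectrum.zeroLocus (homIdeal Z : Set (MvPolynomial (Fin (d + 1)) ℂ)))ᵒᵈ :=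
    OrderDual.toDual ⟨𝔪, le_trans (OrderDual.ofDual (F l.head)).2 (hm l.head)⟩
  -- The inclusion is strict because some coordinate does not vanish on a nonempty set. In the dual
  -- order the largest prime comes first, hence the `cons`.
  have h𝔪 : 𝔪' < F l.head := by
    refine lt_of_le_not_ge (hm l.head) fun h => ?_
    obtain ⟨j, hj⟩ := exists_X_notMem_homIdeal (hirr l.head).nonempty
    exact hj (h (show MvPolynomial.constantCoeff (MvPolynomial.X j) = 0 by simp))
  rw [ringKrullDim_quotient, ← Order.krullDim_orderDual]
  have hlen : ((l.map F hF).cons 𝔪' h𝔪).length = k + 1 := by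
    rw [← hl]
    exact RelSeries.cons_length _ _ _
  refine le_trans (le_of_eq ?_) (Order.LTSeries.length_le_krullDim ((l.map F hF).cons 𝔪' h𝔪))
  rw [hlen, Nat.cast_add, Nat.cast_one]

theorem ringKrullDim_le_of_isIntegral {A B : Type*} [CommRing A] [CommRing B] [Algebra A B]
    [Algebra.IsIntegral A B] : ringKrullDim B ≤ ringKrullDim A :=
  Order.krullDim_le_of_strictMono (PrimeSpectrum.comap (algebraMap A B)) fun I J h => by
    have := I.isPrime
    exact Ideal.IsIntegral.comap_lt_comap (show I.asIdeal < J.asIdeal from h)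

/-- `B` is integral over `A` modulo the kernel, so its dimension is at most that of this quotient.
Killing a nonzero element of the domain `A` lowers the finite dimension. -/
theorem injective_of_ringKrullDim_le {A B : Type*} [CommRing A] [IsDomain A] [CommRing B]
    [Algebra A B] [Algebra.IsIntegral A B] (hA : ringKrullDim A ≠ ⊤) (hA' : ringKrullDim A ≠ ⊥)
    (h : ringKrullDim A ≤ ringKrullDim B) :
    Function.Injective (algebraMap A B) := by
  rw [injective_iff_map_eq_zero]
  intro a ha
  by_contra ha0
  let φ : A ⧸ RingHom.ker (algebraMap A B) →+* B := RingHom.kerLift (algebraMap A B)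
  let _ : Algebra (A ⧸ RingHom.ker (algebraMap A B)) B := φ.toAlgebra
  have : IsScalarTower A (A ⧸ RingHom.ker (algebraMap A B)) B := IsScalarTower.of_algebraMap_eq' rfl
  have : Algebra.IsIntegral (A ⧸ RingHom.ker (algebraMap A B)) B := Algebra.IsIntegral.tower_top A
  have h1 : ringKrullDim B ≤ ringKrullDim (A ⧸ RingHom.ker (algebraMap A B)) :=
    ringKrullDim_le_of_isIntegral
  have h2 := ringKrullDim_succ_le_of_surjective (Ideal.Quotient.mk (RingHom.ker (algebraMap A B)))
    Ideal.Quotient.mk_surjective (mem_nonZeroDivisors_of_ne_zero ha0)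
    (Ideal.Quotient.eq_zero_iff_mem.mpr ha)
  have h3 : ringKrullDim A + 1 ≤ ringKrullDim A := (add_le_add_left (h.trans h1) 1).trans h2
  generalize ringKrullDim A = r at *
  induction r with
  | bot => exact hA' rfl
  | coe r =>
    induction r with
    | top => exact hA rfl
    | coe r =>
      norm_cast at h3
      omega

/-! ### Hilbert functions of finite graded algebras over a polynomial ring -/

theorem finrank_homogeneousSubmodule (k m : ℕ) :
    Module.finrank ℂ (MvPolynomial.homogeneousSubmodule (Fin (k + 1)) ℂ m) = (m + k).choose k := by
  classical
  rw [MvPolynomial.homogeneousSubmodule_eq_finsupp_supported,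
    (AddMonoidAlgebra.supportedEquivFinsupp _).finrank_eq]
  have hs : {s : Fin (k + 1) →₀ ℕ | s.degree = m} =
      ((Finset.univ.finsuppAntidiag m : Finset (Fin (k + 1) →₀ ℕ)) : Set (Fin (k + 1) →₀ ℕ)) := by
    ext s
    simp [Finset.mem_finsuppAntidiag, Finsupp.degree_eq_sum]
  rw [hs, Module.finrank_finsupp_self]
  simp only [Finset.coe_sort_coe, Fintype.card_coe]
  rw [Finset.card_finsuppAntidiag_nat_eq_choose, Finset.card_univ, Fintype.card_fin,
    show k + 1 + m - 1 = m + k by omega, ← Nat.choose_symm_add]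

theorem pow_le_factorial_mul_choose (N k : ℕ) : N ^ k ≤ k.factorial * (N + k).choose k := by
  rw [← Nat.ascFactorial_eq_factorial_mul_choose]
  exact (Nat.pow_le_pow_left (Nat.le_succ N) k).trans (Nat.pow_succ_le_ascFactorial _ _)

theorem factorial_mul_choose_le_pow (N k : ℕ) : k.factorial * (N + k).choose k ≤ (N + k) ^ k := by
  rw [← Nat.ascFactorial_eq_factorial_mul_choose]
  exact Nat.ascFactorial_le_pow_add _ _

theorem tendsto_add_div_pow (a : ℝ) (k : ℕ) :
    Tendsto (fun m : ℕ => ((m : ℝ) + a) ^ k / (m : ℝ) ^ k) atTop (𝓝 1) := by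
  have h1 : Tendsto (fun m : ℕ => 1 + a / (m : ℝ)) atTop (𝓝 (1 + 0)) :=
    tendsto_const_nhds.add (tendsto_const_div_atTop_nhds_zero_nat a)
  have h2 := h1.pow k
  rw [add_zero, one_pow] at h2
  refine h2.congr' ?_
  filter_upwards [eventually_gt_atTop 0] with m hm
  rw [← div_pow]
  congr 1
  field_simp

/-- The bounds say that in degree `m` the space contains, and after a shift by `D` embeds in, a free
module on generators of degrees `e i`. Shifts do not affect the leading term, which is `r * m ^ k /
k!`. -/
theorem tendsto_of_sum_choose_bounds {k r : ℕ} (e : Fin r → ℕ) (D : ℕ) (h : ℕ → ℕ)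
    (hlow : ∀ m, (∀ i, e i ≤ m) → ∑ i, (m - e i + k).choose k ≤ h m)
    (hupp : ∀ m, (∀ i, e i ≤ m) → h m ≤ ∑ i, (m + D - e i + k).choose k) :
    Tendsto (fun m : ℕ => (k.factorial : ℝ) * h m / (m : ℝ) ^ k) atTop (𝓝 r) := by
  let E := ∑ i, e i
  have hE : ∀ i, e i ≤ E := fun i => Finset.single_le_sum (fun _ _ => Nat.zero_le _)
    (Finset.mem_univ i)
  have h1 := (tendsto_add_div_pow (-(E : ℝ)) k).const_mul (r : ℝ)
  have h2 := (tendsto_add_div_pow ((D + k : ℕ) : ℝ) k).const_mul (r : ℝ)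
  rw [mul_one] at h1 h2
  refine tendsto_of_tendsto_of_tendsto_of_le_of_le' h1 h2 ?_ ?_
  · filter_upwards [eventually_ge_atTop E] with m hm
    have h3 : r * (m - E) ^ k ≤ k.factorial * h m := by
      refine le_trans ?_ (Nat.mul_le_mul_left _ (hlow m fun i => (hE i).trans hm))
      rw [Finset.mul_sum]
      refine le_trans ?_ (Finset.sum_le_sum fun i _ => pow_le_factorial_mul_choose (m - e i) k)
      refine le_trans (le_of_eq ?_) (Finset.sum_le_sum fun i _ =>
        Nat.pow_le_pow_left (Nat.sub_le_sub_left (hE i) m) k)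
      simp
    rw [mul_div_assoc', ← sub_eq_add_neg, ← Nat.cast_sub hm]
    refine div_le_div_of_nonneg_right ?_ (by positivity)
    exact_mod_cast h3
  · filter_upwards [eventually_ge_atTop E] with m hm
    have h3 : k.factorial * h m ≤ r * (m + (D + k)) ^ k := by
      refine (Nat.mul_le_mul_left _ (hupp m fun i => (hE i).trans hm)).trans ?_
      rw [Finset.mul_sum]
      refine (Finset.sum_le_sum fun i _ => factorial_mul_choose_le_pow (m + D - e i) k).trans ?_
      refine (Finset.sum_le_sum fun i _ => Nat.pow_le_pow_left
        (show m + D - e i + k ≤ m + (D + k) by omega) k).trans (le_of_eq ?_)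
      simp
    rw [mul_div_assoc', ← Nat.cast_add]
    refine div_le_div_of_nonneg_right ?_ (by positivity)
    exact_mod_cast h3

/-- A family of subspaces with projections onto them, for which the action of the polynomial ring
is graded. -/
structure GradedPieces (k : ℕ) (R : Type) [CommRing R] [Algebra ℂ R]
    [Algebra (MvPolynomial (Fin (k + 1)) ℂ) R] where
  piece : ℕ → Submodule ℂ R
  proj : ℕ → R →ₗ[ℂ] R
  proj_apply : ∀ {i j b}, b ∈ piece j → proj i b = if i = j then b else 0
  smul_mem : ∀ {i j} {p : MvPolynomial (Fin (k + 1)) ℂ} {b}, p.IsHomogeneous i → b ∈ piece j →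
    p • b ∈ piece (i + j)
  finite : ∀ i, FiniteDimensional ℂ (piece i)
  span_eq_top : Submodule.span (MvPolynomial (Fin (k + 1)) ℂ) {b | ∃ i, b ∈ piece i} = ⊤

/-- Take a maximal independent subset of `G`: elements with a nonzero multiple in its span form a
submodule containing `G`, hence everything, and finite generation gives a common multiplier.
Choosing inside `G` makes homogeneous `a i` available later. -/
theorem exists_linearIndependent_spanning {S R : Type} [CommRing S] [IsDomain S] [CommRing R]
    [Algebra S R] [Module.Finite S R] {G : Set R} (hG : Submodule.span S G = ⊤) :
    ∃ (r : ℕ) (a : Fin r → R) (s : S), (∀ i, a i ∈ G) ∧ LinearIndependent S a ∧ s ≠ 0 ∧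
      ∀ b, s • b ∈ Submodule.span S (Set.range a) := by
  obtain ⟨T, hT, hTmax⟩ := exists_maximal_linearIndepOn S (fun g : G => (g : R))
  have hfin : Finite T := LinearIndependent.finite hT
  have : Fintype T := Fintype.ofFinite T
  let a : Fin (Fintype.card T) → R := fun i => ((Fintype.equivFin T).symm i : G)
  have ha : Set.range a = (fun g : G => (g : R)) '' T := by
    ext x
    constructor
    · rintro ⟨i, rfl⟩
      exact ⟨_, ((Fintype.equivFin T).symm i).2, rfl⟩
    · rintro ⟨g, hg, rfl⟩
      exact ⟨Fintype.equivFin T ⟨g, hg⟩, by simp [a]⟩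
  set N := Submodule.span S (Set.range a) with hN
  let P : Submodule S R :=
    { carrier := {b | ∃ s : S, s ≠ 0 ∧ s • b ∈ N}
      zero_mem' := ⟨1, one_ne_zero, by simp⟩
      add_mem' := by
        rintro b c ⟨s, hs, hb⟩ ⟨t, ht, hc⟩
        refine ⟨s * t, mul_ne_zero hs ht, ?_⟩
        rw [smul_add]
        refine N.add_mem ?_ ?_
        · rw [mul_comm, mul_smul]
          exact N.smul_mem _ hb
        · rw [mul_smul]
          exact N.smul_mem _ hc
      smul_mem' := by
        rintro c b ⟨s, hs, hb⟩
        exact ⟨s, hs, by rw [smul_comm]; exact N.smul_mem _ hb⟩ }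
  have hP : P = ⊤ := by
    rw [eq_top_iff, ← hG, Submodule.span_le]
    intro g hg
    by_cases hgT : (⟨g, hg⟩ : G) ∈ T
    · exact ⟨1, one_ne_zero, by
        rw [one_smul, hN, ha]
        exact Submodule.subset_span ⟨⟨g, hg⟩, hgT, rfl⟩⟩
    · obtain ⟨s, hs, hsg⟩ := hTmax ⟨g, hg⟩ hgT
      exact ⟨s, hs, by rw [hN, ha]; exact hsg⟩
  obtain ⟨B, hB⟩ := (Module.finite_def (R := S) (M := R)).mp inferInstance
  have hPB : ∀ b, ∃ s : S, s ≠ 0 ∧ s • b ∈ N := fun b => by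
    have : b ∈ P := hP ▸ Submodule.mem_top
    exact this
  choose t ht htN using hPB
  refine ⟨Fintype.card T, a, ∏ b ∈ B, t b, fun i => ((Fintype.equivFin T).symm i : G).2,
    LinearIndependent.comp hT _ (Fintype.equivFin T).symm.injective,
    Finset.prod_ne_zero_iff.mpr fun b _ => ht b, fun b => ?_⟩
  have hle : (⊤ : Submodule S R) ≤ N.comap (LinearMap.lsmul S R (∏ b ∈ B, t b)) := by
    classical
    rw [← hB, Submodule.span_le]
    intro c hc
    change (∏ b ∈ B, t b) • c ∈ N
    rw [← Finset.prod_erase_mul B t hc, mul_smul]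
    exact N.smul_mem _ (htN c)
  exact hle (Submodule.mem_top (x := b))

theorem GradedPieces.proj_smul {k : ℕ} {R : Type} [CommRing R] [Algebra ℂ R]
    [Algebra (MvPolynomial (Fin (k + 1)) ℂ) R] (𝒢 : GradedPieces k R) {N j : ℕ} (hj : j ≤ N)
    {b : R} (hb : b ∈ 𝒢.piece j) (p : MvPolynomial (Fin (k + 1)) ℂ) :
    𝒢.proj N (p • b) = MvPolynomial.homogeneousComponent (N - j) p • b := by
  conv_lhs => rw [← MvPolynomial.sum_homogeneousComponent p, Finset.sum_smul, map_sum]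
  rw [Finset.sum_congr rfl fun i _ => 𝒢.proj_apply (𝒢.smul_mem
    (MvPolynomial.homogeneousComponent_isHomogeneous i p) hb)]
  by_cases h : N - j < p.totalDegree + 1
  · rw [Finset.sum_eq_single (N - j)]
    · rw [if_pos (by omega)]
    · intro i _ hi
      rw [if_neg (by omega)]
    · intro h'
      exact absurd (Finset.mem_range.mpr h) h'
  · rw [MvPolynomial.homogeneousComponent_eq_zero _ _ (by omega), zero_smul]
    refine Finset.sum_eq_zero fun i hi => if_neg ?_
    have := Finset.mem_range.mp hi
    omega

/-- `r` is the rank of `R` over the polynomial ring. The free module on homogeneous `a i` bounds the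
Hilbert function from below; multiplication by a component of `s` embeds `R` into that free module
and bounds it from above. -/
theorem exists_linearIndependent_tendsto {k : ℕ} {R : Type} [CommRing R] [IsDomain R] [Algebra ℂ R]
    [Algebra (MvPolynomial (Fin (k + 1)) ℂ) R] [IsScalarTower ℂ (MvPolynomial (Fin (k + 1)) ℂ) R]
    [Module.Finite (MvPolynomial (Fin (k + 1)) ℂ) R]
    (hinj : Function.Injective (algebraMap (MvPolynomial (Fin (k + 1)) ℂ) R))
    (𝒢 : GradedPieces k R) :
    ∃ (r : ℕ) (a : Fin r → R) (s : MvPolynomial (Fin (k + 1)) ℂ),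
      LinearIndependent (MvPolynomial (Fin (k + 1)) ℂ) a ∧ s ≠ 0 ∧
      (∀ b, s • b ∈ Submodule.span (MvPolynomial (Fin (k + 1)) ℂ) (Set.range a)) ∧
      Tendsto (fun m : ℕ => (k.factorial : ℝ) * (Module.finrank ℂ (𝒢.piece m) : ℕ) / (m : ℝ) ^ k)
        atTop (𝓝 r) := by
  obtain ⟨r, a, s, haG, ha, hs, hsa⟩ := exists_linearIndependent_spanning 𝒢.span_eq_top
  choose e he using haG
  refine ⟨r, a, s, ha, hs, hsa, ?_⟩
  -- `s` need not be homogeneous, but one nonzero component suffices: the relation `s • b = ∑ p i •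
  -- a i` can be projected to degree `m + D`.
  obtain ⟨D, hD⟩ : ∃ D, MvPolynomial.homogeneousComponent D s ≠ 0 := by
    by_contra! h
    apply hs
    rw [← MvPolynomial.sum_homogeneousComponent s]
    exact Finset.sum_eq_zero fun i _ => h i
  have hsmul : ∀ {p : MvPolynomial (Fin (k + 1)) ℂ} {b : R}, p ≠ 0 → p • b = 0 → b = 0 := by
    intro p b hp hpb
    rw [Algebra.smul_def, mul_eq_zero] at hpb
    exact hpb.resolve_left fun h => hp (hinj (by rw [h, map_zero]))
  have hfd : ∀ i, FiniteDimensional ℂ (MvPolynomial.homogeneousSubmodule (Fin (k + 1)) ℂ i) :=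
    fun i => Module.Finite.iff_fg.mpr (MvPolynomial.homogeneousSubmodule_fg _ _ i)
  let Φ : (c : Fin r → ℕ) →
      (∀ i, MvPolynomial.homogeneousSubmodule (Fin (k + 1)) ℂ (c i)) →ₗ[ℂ] R := fun c =>
    ∑ i, (LinearMap.toSpanSingleton (MvPolynomial (Fin (k + 1)) ℂ) R (a i)).restrictScalars ℂ ∘ₗ
      (MvPolynomial.homogeneousSubmodule (Fin (k + 1)) ℂ (c i)).subtype ∘ₗ LinearMap.proj i
  have hΦ : ∀ c p, Φ c p = ∑ i, (p i : MvPolynomial (Fin (k + 1)) ℂ) • a i := by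
    intro c p
    simp [Φ]
  refine tendsto_of_sum_choose_bounds e D _ (fun m hm => ?_) fun m hm => ?_
  · have := 𝒢.finite m
    let c : Fin r → ℕ := fun i => m - e i
    have hmem : ∀ p, Φ c p ∈ 𝒢.piece m := fun p => by
      rw [hΦ]
      refine Submodule.sum_mem _ fun i _ => ?_
      have := 𝒢.smul_mem (p i).2 (he i)
      rwa [Nat.sub_add_cancel (hm i)] at this
    have hinj' : Function.Injective ((Φ c).codRestrict _ hmem) := by
      rw [injective_iff_map_eq_zero]
      intro p hp
      have hp' := congrArg Subtype.val hp
      rw [LinearMap.codRestrict_apply, hΦ] at hp'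
      funext i
      exact Subtype.ext (Fintype.linearIndependent_iff.mp ha _ hp' i)
    have := LinearMap.finrank_le_finrank_of_injective hinj'
    rw [Module.finrank_pi_fintype] at this
    simpa only [finrank_homogeneousSubmodule] using this
  · let c : Fin r → ℕ := fun i => m + D - e i
    let μ : R →ₗ[ℂ] R := 
      (LinearMap.lsmul (MvPolynomial (Fin (k + 1)) ℂ) R
        (MvPolynomial.homogeneousComponent D s)).restrictScalars ℂ
    have hμ : Function.Injective μ := by
      rw [injective_iff_map_eq_zero]
      intro b hb
      exact hsmul hD (by simpa [μ] using hb)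
    have hle : (𝒢.piece m).map μ ≤ LinearMap.range (Φ c) := by
      rintro _ ⟨b, hb, rfl⟩
      obtain ⟨p, hp⟩ := (Submodule.mem_span_range_iff_exists_fun _).mp (hsa b)
      refine ⟨fun i => ⟨MvPolynomial.homogeneousComponent (c i) (p i),
        MvPolynomial.homogeneousComponent_isHomogeneous _ _⟩, ?_⟩
      rw [hΦ]
      have h1 := congrArg (𝒢.proj (m + D)) hp
      rw [map_sum, 𝒢.proj_smul (Nat.le_add_right m D) hb, Nat.add_sub_cancel_left] at h1
      simp only [μ, LinearMap.lsmul_apply, LinearMap.coe_restrictScalars]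
      rw [← h1]
      exact Finset.sum_congr rfl fun i _ =>
        (𝒢.proj_smul ((hm i).trans (Nat.le_add_right m D)) (he i) (p i)).symm
    rw [(Submodule.equivMapOfInjective μ hμ _).finrank_eq]
    refine (Submodule.finrank_mono hle).trans ((LinearMap.finrank_range_le _).trans ?_)
    rw [Module.finrank_pi_fintype]
    simp only [finrank_homogeneousSubmodule, c, le_refl]

/-! ### Kernel vectors -/

/-- The factor `c` is there because membership in `homIdeal` is tested on the whole affine cone. -/
theorem exists_annihilates_of_mem_locus {d k n : ℕ} {γ : Tensor d k n} {p : PP d}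
    (hp : p ∈ locus γ) : ∃ v : Fin n → ℂ, v ≠ 0 ∧
      ∀ c : ℂ, Annihilates γ (c • Projectivization.rep p) v := by
  obtain ⟨v, hv, hpv⟩ := hp
  refine ⟨v, hv, fun c φ ω => ?_⟩
  set x := Projectivization.rep p
  have h1 := coeffMatrix_mul_mulVec γ φ (ExteriorAlgebra.ι ℂ x) ω v
  rw [hpv, map_zero] at h1
  have h2 : ∑ j, x j • (Pi.single j 1 : Fin (d + 1) → ℂ) = x := by
    ext i
    simp [Finset.sum_apply, Pi.single_apply]
  rw [← h2, map_sum, Finset.sum_mul, map_sum, Matrix.sum_mulVec] at h1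
  simp only [map_smul, smul_mul_assoc, Matrix.smul_mulVec] at h1
  simp only [Pi.smul_apply, smul_eq_mul, mul_smul, ← Finset.smul_sum]
  refine (congrArg (c • ·) h1).trans (smul_zero c)

theorem piScalarRight_baseChange_mulVecLin {n : ℕ} {R : Type} [CommRing R] [Algebra ℂ R]
    (M : Matrix (Fin n) (Fin n) ℂ) (z : R ⊗[ℂ] (Fin n → ℂ)) :
    TensorProduct.piScalarRight ℂ R R (Fin n) (M.mulVecLin.baseChange R z) =
      (M.map (algebraMap ℂ R)).mulVec (TensorProduct.piScalarRight ℂ R R (Fin n) z) := by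
  induction z using TensorProduct.induction_on with
  | zero => simp
  | tmul r v =>
    ext i
    simp only [LinearMap.baseChange_tmul, TensorProduct.piScalarRight_apply,
      TensorProduct.piScalarRightHom_tmul, Matrix.mulVecLin_apply, Matrix.mulVec, dotProduct,
      Matrix.map_apply, Algebra.smul_def, map_mul, map_sum, Finset.sum_mul,
      mul_assoc]
  | add a b ha hb => rw [map_add, map_add, ha, hb, map_add, Matrix.mulVec_add]

/-- The coordinate functions, as a point with entries in the homogeneous coordinate ring. -/
def coordPoint {d : ℕ} (Z : Set (PP d)) : Fin (d + 1) → CoordRing Z :=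
  fun j => Ideal.Quotient.mk (homIdeal Z) (MvPolynomial.X j)

theorem annihilates_of_mem_ker {d k n : ℕ} {γ : Tensor d k n} {Z : Set (PP d)}
    {z : CoordRing Z ⊗[ℂ] (Fin n → ℂ)} (hz : coordWedge γ Z z = 0) :
    Annihilates γ (coordPoint Z)
      (TensorProduct.piScalarRight ℂ (CoordRing Z) (CoordRing Z) (Fin n) z) := by
  intro φ ω
  have h1 := congrArg (TensorProduct.piScalarRight ℂ (CoordRing Z) (CoordRing Z) (Fin n))
    (congrArg ((contract (Fin n → ℂ) (φ ∘ₗ LinearMap.mulRight ℂ ω)).baseChange (CoordRing Z)) hz)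
  rw [map_zero, map_zero, coordWedge, LinearMap.sum_apply, map_sum, map_sum] at h1
  rw [← h1]
  refine Finset.sum_congr rfl fun j _ => ?_
  rw [LinearMap.smul_apply, map_smul, map_smul, ← LinearMap.comp_apply,
    ← LinearMap.baseChange_comp, ← piScalarRight_baseChange_mulVecLin]
  have h2 : contract (Fin n → ℂ) (φ ∘ₗ LinearMap.mulRight ℂ ω) ∘ₗ
      toMap (wedge γ (ExteriorAlgebra.ι ℂ (Pi.single j 1))) =
      (coeffMatrix γ φ (ExteriorAlgebra.ι ℂ (Pi.single j 1) * ω)).mulVecLin :=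
    LinearMap.ext fun v => (coeffMatrix_mul_mulVec γ φ _ ω v).symm
  rw [h2]
  rfl

theorem finrank_fractionRing_tensorProduct (R K : Type) [CommRing R] [IsDomain R] [AddCommGroup K]
    [Module R K] :
    Module.finrank (FractionRing R) (FractionRing R ⊗[R] K) = Module.finrank R K :=
  (TensorProduct.isBaseChange R K (FractionRing R)).finrank_eq

theorem exists_linearIndependent_map_equiv {R M P : Type} [CommRing R] [AddCommGroup M]
    [Module R M] [AddCommGroup P] [Module R P] (E : M ≃ₗ[R] P) (N : Submodule R M) :
    ∃ κ : Fin (Module.finrank R N) → P, LinearIndependent R κ ∧ ∀ i, ∃ z ∈ N, E z = κ i := by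
  obtain ⟨f, hf⟩ := exists_linearIndependent_of_le_finrank (le_refl (Module.finrank R N))
  refine ⟨fun i => E (f i), ?_, fun i => ⟨f i, (f i).2, rfl⟩⟩
  exact hf.map' (E.toLinearMap ∘ₗ N.subtype)
    (LinearMap.ker_eq_bot.mpr (E.injective.comp Subtype.val_injective))

/-- Passing to the fraction field preserves rank, so `genericKernelDim` many independent solutions
exist over the coordinate ring itself, without denominators. -/
theorem exists_linearIndependent_annihilates {d k n : ℕ} (γ : Tensor d k n) {Z : Set (PP d)}
    (hZ : (homIdeal Z).IsPrime) :
    ∃ κ : Fin (genericKernelDim γ Z) → (Fin n → CoordRing Z),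
      LinearIndependent (CoordRing Z) κ ∧ ∀ i, Annihilates γ (coordPoint Z) (κ i) := by
  have : IsDomain (CoordRing Z) := Ideal.Quotient.isDomain (homIdeal Z)
  have h1 : genericKernelDim γ Z = Module.finrank (CoordRing Z) (LinearMap.ker (coordWedge γ Z)) := by
    rw [genericKernelDim]
    exact finrank_fractionRing_tensorProduct (CoordRing Z) (LinearMap.ker (coordWedge γ Z))
  rw [h1]
  obtain ⟨κ, hκ, hκ'⟩ := exists_linearIndependent_map_equiv
    (TensorProduct.piScalarRight ℂ (CoordRing Z) (CoordRing Z) (Fin n)) (LinearMap.ker (coordWedge γ Z))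
  refine ⟨κ, hκ, fun i => ?_⟩
  obtain ⟨z, hz, hzκ⟩ := hκ' i
  rw [← hzκ]
  exact annihilates_of_mem_ker hz

/-! ### Quotients of the polynomial ring as algebras over a smaller polynomial ring -/

theorem algebraMap_injective_of_le_ringKrullDim {k : ℕ} {R : Type} [CommRing R]
    [Algebra (MvPolynomial (Fin (k + 1)) ℂ) R] [Module.Finite (MvPolynomial (Fin (k + 1)) ℂ) R]
    (hR : (k + 1 : WithBot ℕ∞) ≤ ringKrullDim R) :
    Function.Injective (algebraMap (MvPolynomial (Fin (k + 1)) ℂ) R) := by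
  have hdim : ringKrullDim (MvPolynomial (Fin (k + 1)) ℂ) = ((k + 1 : ℕ) : WithBot ℕ∞) := by
    rw [MvPolynomial.ringKrullDim_of_isNoetherianRing, ringKrullDim_eq_zero_of_field]
    simp
  have : Algebra.IsIntegral (MvPolynomial (Fin (k + 1)) ℂ) R := Algebra.IsIntegral.of_finite _ _
  refine injective_of_ringKrullDim_le ?_ ?_ ?_
  · rw [hdim]
    exact fun h => ENat.natCast_ne_top (k + 1) (WithBot.coe_injective h)
  · rw [hdim]
    exact WithBot.coe_ne_bot
  · rw [hdim]
    exact_mod_cast hR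

/-- A linear functional that vanishes on no nonzero ideal. -/
theorem exists_linearMap_forall_mul_eq_zero {S R : Type} [CommRing S] [IsDomain S] [CommRing R]
    [IsDomain R] [Algebra S R] [Algebra.IsIntegral S R] {r : ℕ} {a : Fin r → R} {s : S}
    (hinj : Function.Injective (algebraMap S R))
    (ha : LinearIndependent S a) (hs : s ≠ 0)
    (hsa : ∀ b, s • b ∈ Submodule.span S (Set.range a)) :
    ∃ φ : R →ₗ[S] S, ∀ z, (∀ e, φ (e * z) = 0) → z = 0 := by
  cases r with
  -- With no `a i`, `s • 1 = 0`, which injectivity excludes.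
  | zero =>
    have h := hsa 1
    rw [Set.range_eq_empty, Submodule.span_empty, Submodule.mem_bot, Algebra.smul_def,
      mul_one] at h
    exact absurd (hinj (by rw [h, map_zero])) hs
  | succ r =>
    -- `φ b` is the coefficient of `a 0` in `s • b`.
    let φ : R →ₗ[S] S := Finsupp.lapply 0 ∘ₗ ha.repr ∘ₗ
      (LinearMap.lsmul S R s).codRestrict (Submodule.span S (Set.range a)) hsa
    have hφ : φ (a 0) = s := by
      have : (LinearMap.lsmul S R s).codRestrict (Submodule.span S (Set.range a)) hsa (a 0) =
          s • ⟨a 0, Submodule.subset_span ⟨0, rfl⟩⟩ := rfl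
      simp only [φ, LinearMap.comp_apply, this, map_smul]
      rw [ha.repr_eq_single 0 _ rfl]
      simp
    refine ⟨φ, fun z hz => ?_⟩
    by_contra hz0
    -- By algebraicity a nonzero `z` divides some `t • a 0` with `t ≠ 0`, where `φ` takes the value
    -- `t * s ≠ 0`.
    obtain ⟨c, t, ht, htc⟩ := Algebra.IsAlgebraic.exists_smul_eq_mul S (a 0) hz0
    have h1 := hz c
    rw [mul_comm, ← htc, map_smul, hφ, smul_eq_mul] at h1
    exact (mul_ne_zero ht hs) h1

section Quotient

variable {d k n : ℕ} {R : Type} [CommRing R] [Algebra ℂ R]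
  [Algebra (MvPolynomial (Fin (k + 1)) ℂ) R]
  {π : MvPolynomial (Fin (d + 1)) ℂ →ₐ[ℂ] R} {γ : Tensor d k n} {Z : Set (PP d)}
  {ℓ : Fin (k + 1) → MvPolynomial (Fin (d + 1)) ℂ}
  {X : Fin (d + 1) → Matrix (Fin n) (Fin n) (MvPolynomial (Fin (k + 1)) ℂ)}

theorem aeval_map_X (f : MvPolynomial (Fin (d + 1)) ℂ) :
    MvPolynomial.aeval (fun j => π (MvPolynomial.X j)) f = π f := by
  have : MvPolynomial.aeval (fun j => π (MvPolynomial.X j)) = π :=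
    MvPolynomial.algHom_ext fun j => by simp
  rw [this]

theorem aeval_aeval_map_X (hℓ : ∀ p, algebraMap (MvPolynomial (Fin (k + 1)) ℂ) R p =
      π (MvPolynomial.aeval ℓ p)) (p : MvPolynomial (Fin (k + 1)) ℂ) :
    MvPolynomial.aeval (fun l => MvPolynomial.aeval (fun j => π (MvPolynomial.X j)) (ℓ l)) p =
      algebraMap (MvPolynomial (Fin (k + 1)) ℂ) R p := by
  rw [hℓ]
  have : MvPolynomial.aeval (fun l => MvPolynomial.aeval (fun j => π (MvPolynomial.X j)) (ℓ l)) =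
      π.comp (MvPolynomial.aeval ℓ) :=
    MvPolynomial.algHom_ext fun l => by simp [aeval_map_X]
  rw [this, AlgHom.comp_apply]

/-- At each point of the cone over `Z` a kernel vector is an eigenvector of the specialised `X j`
with eigenvalue the `j`-th coordinate. So the characteristic polynomial of `X j`, evaluated at that
coordinate, vanishes on the cone and hence in `R`. -/
theorem isIntegral_map_X (hπ0 : ∀ f, π f = 0 ↔ f ∈ homIdeal Z)
    (hℓ : ∀ p, algebraMap (MvPolynomial (Fin (k + 1)) ℂ) R p = π (MvPolynomial.aeval ℓ p))
    (hX : ActsByCoordinates γ ℓ X) (hZ : Z ⊆ locus γ) (j : Fin (d + 1)) :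
    IsIntegral (MvPolynomial (Fin (k + 1)) ℂ) (π (MvPolynomial.X j)) := by
  refine ⟨(X j).charpoly, (X j).charpoly_monic, ?_⟩
  have h0 : algebraMap (MvPolynomial (Fin (k + 1)) ℂ) R =
      (π : MvPolynomial (Fin (d + 1)) ℂ →+* R).comp (MvPolynomial.aeval ℓ).toRingHom :=
    RingHom.ext hℓ
  rw [h0]
  change Polynomial.eval₂ _ ((π : MvPolynomial (Fin (d + 1)) ℂ →+* R) (MvPolynomial.X j)) _ = 0
  rw [← Polynomial.hom_eval₂]
  refine (hπ0 _).mpr (mem_homIdeal.mpr fun p hp c => ?_)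
  obtain ⟨v, hv, hvp⟩ := exists_annihilates_of_mem_locus (hZ hp)
  have h1 := hX ℂ _ v (hvp c) j
  set x := c • Projectivization.rep p
  rw [Polynomial.hom_eval₂, MvPolynomial.eval_X]
  have h2 : (MvPolynomial.eval x).comp (MvPolynomial.aeval ℓ).toRingHom =
      (MvPolynomial.aeval (R := ℂ) fun l => MvPolynomial.aeval x (ℓ l)).toRingHom :=
    MvPolynomial.ringHom_ext (fun c => by simp) fun l => by simp [MvPolynomial.aeval_eq_eval]
  rw [h2, ← Polynomial.eval_map, ← Matrix.charpoly_map, Matrix.eval_charpoly,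
    ← Matrix.exists_mulVec_eq_zero_iff]
  refine ⟨v, hv, ?_⟩
  rw [Matrix.sub_mulVec, sub_eq_zero]
  refine Eq.trans ?_ h1.symm
  simp [Matrix.scalar_apply, ← Matrix.smul_one_eq_diagonal, Matrix.smul_mulVec]

theorem finite_of_subset_locus [IsScalarTower ℂ (MvPolynomial (Fin (k + 1)) ℂ) R]
    (hπ : Function.Surjective π) (hπ0 : ∀ f, π f = 0 ↔ f ∈ homIdeal Z)
    (hℓ : ∀ p, algebraMap (MvPolynomial (Fin (k + 1)) ℂ) R p = π (MvPolynomial.aeval ℓ p))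
    (hX : ActsByCoordinates γ ℓ X) (hZ : Z ⊆ locus γ) :
    Module.Finite (MvPolynomial (Fin (k + 1)) ℂ) R := by
  set x : Fin (d + 1) → R := fun j => π (MvPolynomial.X j)
  have hadj : Algebra.adjoin (MvPolynomial (Fin (k + 1)) ℂ) (Set.range x) = ⊤ := by
    rw [eq_top_iff]
    intro b _
    obtain ⟨f, rfl⟩ := hπ b
    induction f using MvPolynomial.induction_on with
    | C c =>
      rw [← MvPolynomial.algebraMap_eq, AlgHom.commutes,
        IsScalarTower.algebraMap_apply ℂ (MvPolynomial (Fin (k + 1)) ℂ) R]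
      exact Subalgebra.algebraMap_mem _ _
    | add p q hp hq => rw [map_add]; exact Subalgebra.add_mem _ (hp trivial) (hq trivial)
    | mul_X p j hp =>
      rw [map_mul]
      exact Subalgebra.mul_mem _ (hp trivial) (Algebra.subset_adjoin ⟨j, rfl⟩)
  have h4 := Algebra.finite_adjoin_of_finite_of_isIntegral
    (R := MvPolynomial (Fin (k + 1)) ℂ) (Set.finite_range x)
    (by rintro _ ⟨j, rfl⟩; exact isIntegral_map_X hπ0 hℓ hX hZ j)
  rw [hadj] at h4
  exact Module.Finite.equiv (Subalgebra.topEquiv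
    (R := MvPolynomial (Fin (k + 1)) ℂ) (A := R)).toLinearEquiv

theorem map_homogeneousComponent_congr (hπ0 : ∀ f, π f = 0 ↔ f ∈ homIdeal Z)
    {f g : MvPolynomial (Fin (d + 1)) ℂ} (h : π f = π g) (i : ℕ) :
    π (MvPolynomial.homogeneousComponent i f) = π (MvPolynomial.homogeneousComponent i g) := by
  rw [← sub_eq_zero, ← map_sub, hπ0] at h ⊢
  rw [← map_sub]
  exact homogeneousComponent_mem_homIdeal h i

/-- The grading of a quotient of the polynomial ring by a homogeneous ideal. -/
def quotientGradedPieces (hπ : Function.Surjective π) (hπ0 : ∀ f, π f = 0 ↔ f ∈ homIdeal Z)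
    (hℓ : ∀ p, algebraMap (MvPolynomial (Fin (k + 1)) ℂ) R p = π (MvPolynomial.aeval ℓ p))
    (hℓ1 : ∀ l, (ℓ l).IsHomogeneous 1) : GradedPieces k R where
  piece m := (MvPolynomial.homogeneousSubmodule (Fin (d + 1)) ℂ m).map π.toLinearMap
  proj i :=
    { toFun := fun b => π (MvPolynomial.homogeneousComponent i (Function.surjInv hπ b))
      map_add' := fun b c => by
        rw [← map_add, ← map_add]
        exact map_homogeneousComponent_congr hπ0 (by simp [Function.surjInv_eq]) i
      map_smul' := fun c b => by
        rw [RingHom.id_apply, ← map_smul, ← map_smul]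
        exact map_homogeneousComponent_congr hπ0 (by simp [Function.surjInv_eq]) i }
  proj_apply := by
    rintro i j _ ⟨f, hf, rfl⟩
    change π (MvPolynomial.homogeneousComponent i (Function.surjInv hπ (π f))) =
      if i = j then π f else 0
    rw [map_homogeneousComponent_congr hπ0 (Function.surjInv_eq hπ (π f)) i,
      MvPolynomial.homogeneousComponent_of_mem hf]
    split_ifs <;> simp
  smul_mem := by
    rintro i j p _ hp ⟨f, hf, rfl⟩
    refine ⟨MvPolynomial.aeval ℓ p * f, ?_, ?_⟩
    · refine MvPolynomial.IsHomogeneous.mul ?_ hf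
      simpa using hp.aeval ℓ hℓ1
    · rw [Algebra.smul_def, hℓ]
      exact map_mul π _ _
  finite i := by
    have : FiniteDimensional ℂ (MvPolynomial.homogeneousSubmodule (Fin (d + 1)) ℂ i) :=
      Module.Finite.iff_fg.mpr (MvPolynomial.homogeneousSubmodule_fg _ _ i)
    infer_instance
  span_eq_top := by
    rw [eq_top_iff]
    intro b _
    obtain ⟨f, rfl⟩ := hπ b
    rw [← MvPolynomial.sum_homogeneousComponent f, map_sum]
    exact Submodule.sum_mem _ fun i _ => Submodule.subset_span
      ⟨i, _, MvPolynomial.homogeneousComponent_isHomogeneous i f, rfl⟩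

end Quotient

/-! ### The contribution of a component -/

theorem Annihilates.smul {d k n : ℕ} {γ : Tensor d k n} {R : Type} [CommRing R] [Algebra ℂ R]
    {x : Fin (d + 1) → R} {z : Fin n → R} (hz : Annihilates γ x z) (c : R) :
    Annihilates γ x (c • z) := fun φ ω => by
  simp only [Matrix.mulVec_smul, smul_comm _ c, ← Finset.smul_sum]
  rw [hz φ ω, smul_zero]

theorem Annihilates.sum {d k n : ℕ} {γ : Tensor d k n} {R ι : Type} [CommRing R] [Algebra ℂ R]
    {x : Fin (d + 1) → R} {s : Finset ι} {z : ι → Fin n → R}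
    (hz : ∀ i ∈ s, Annihilates γ x (z i)) :
    Annihilates γ x (∑ i ∈ s, z i) := fun φ ω => by
  simp only [Matrix.mulVec_sum, Finset.smul_sum]
  rw [Finset.sum_comm]
  exact Finset.sum_eq_zero fun i hi => hz i hi φ ω

theorem mulVec_comp_linearMap {S R : Type} [CommRing S] [CommRing R] [Algebra S R] {n : ℕ}
    (φ : R →ₗ[S] S) (F : Matrix (Fin n) (Fin n) S) (z : Fin n → R) :
    F.mulVec (φ ∘ z) = φ ∘ (F.map (algebraMap S R)).mulVec z := by
  ext i
  simp [Matrix.mulVec, dotProduct, ← Algebra.smul_def]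

/-- The vectors are `φ ∘ (a i • κ j)`. Although `φ` is far from injective, it loses no solution: if
`φ ∘ z = 0`, then `φ (e * z) = 0` in each entry for every `e`, because `e` acts through a matrix
over the small ring, and so `z = 0`. -/
theorem exists_family_of_quotient {d k n m : ℕ} {R : Type} [CommRing R] [IsDomain R] [Algebra ℂ R]
    [Algebra (MvPolynomial (Fin (k + 1)) ℂ) R] [IsScalarTower ℂ (MvPolynomial (Fin (k + 1)) ℂ) R]
    {π : MvPolynomial (Fin (d + 1)) ℂ →ₐ[ℂ] R} {γ : Tensor d k n} {Z : Set (PP d)}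
    {ℓ : Fin (k + 1) → MvPolynomial (Fin (d + 1)) ℂ}
    {X : Fin (d + 1) → Matrix (Fin n) (Fin n) (MvPolynomial (Fin (k + 1)) ℂ)}
    (hπ : Function.Surjective π) (hπ0 : ∀ f, π f = 0 ↔ f ∈ homIdeal Z)
    (hℓ : ∀ p, algebraMap (MvPolynomial (Fin (k + 1)) ℂ) R p = π (MvPolynomial.aeval ℓ p))
    (hℓ1 : ∀ l, (ℓ l).IsHomogeneous 1) (hX : ActsByCoordinates γ ℓ X) (hZ : Z ⊆ locus γ)
    (hR : (k + 1 : WithBot ℕ∞) ≤ ringKrullDim R) {κ : Fin m → Fin n → R}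
    (hκ : LinearIndependent R κ) (hκγ : ∀ i, Annihilates γ (fun j => π (MvPolynomial.X j)) (κ i)) :
    ∃ r : ℕ, Tendsto (fun i : ℕ => (k.factorial : ℝ) * (Module.finrank ℂ
        ((MvPolynomial.homogeneousSubmodule (Fin (d + 1)) ℂ i).map π.toLinearMap) : ℕ) /
          (i : ℝ) ^ k) atTop (𝓝 r) ∧
      ∃ w : Fin r × Fin m → Fin n → MvPolynomial (Fin (k + 1)) ℂ,
        ∀ f F, Represents γ ℓ F f → (f ∈ homIdeal Z → ∀ α, F.mulVec (w α) = 0) ∧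
          (f ∉ homIdeal Z →
            LinearIndependent (MvPolynomial (Fin (k + 1)) ℂ) fun α => F.mulVec (w α)) := by
  have := finite_of_subset_locus hπ hπ0 hℓ hX hZ
  have : Algebra.IsIntegral (MvPolynomial (Fin (k + 1)) ℂ) R := Algebra.IsIntegral.of_finite _ _
  have hinj := algebraMap_injective_of_le_ringKrullDim hR
  obtain ⟨r, a, s, ha, hs, hsa, hlim⟩ :=
    exists_linearIndependent_tendsto hinj (quotientGradedPieces hπ hπ0 hℓ hℓ1)
  obtain ⟨φ, hφ⟩ := exists_linearMap_forall_mul_eq_zero hinj ha hs hsa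
  -- `φ` is linear over the small polynomial ring, so it commutes with `F`, which acts on `z` as `π
  -- f`.
  have hF : ∀ {f F} {z : Fin n → R}, Represents γ ℓ F f →
      Annihilates γ (fun j => π (MvPolynomial.X j)) z →
      F.mulVec (φ ∘ z) = φ ∘ (π f • z) := by
    intro f F z hf hz
    have h1 := hf R _ z hz
    rw [aeval_map_X] at h1
    rw [mulVec_comp_linearMap, ← h1]
    congr 2
    ext p q
    exact (aeval_aeval_map_X hℓ _).symm
  have hu : ∀ α : Fin r × Fin m,
      Annihilates γ (fun j => π (MvPolynomial.X j)) (a α.1 • κ α.2) :=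
    fun α => (hκγ α.2).smul _
  refine ⟨r, hlim, fun α => φ ∘ (a α.1 • κ α.2), fun f F hf => ⟨fun hfZ α => ?_, fun hfZ => ?_⟩⟩
  · rw [hF hf (hu α), (hπ0 f).mpr hfZ, zero_smul]
    ext
    simp
  · rw [Fintype.linearIndependent_iff]
    intro c hc
    set z : Fin n → R := ∑ α : Fin r × Fin m, c α • (a α.1 • κ α.2) with hz
    have hzγ : Annihilates γ (fun j => π (MvPolynomial.X j)) z := by
      refine Annihilates.sum fun α _ => ?_
      rw [← algebraMap_smul R (c α)]
      exact (hu α).smul _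
    have hzφ : φ ∘ (π f • z) = 0 := by
      rw [← hc]
      ext1 i
      simp only [hF hf (hu _), hz, Function.comp_apply, Finset.sum_apply, Pi.smul_apply,
        smul_eq_mul, Finset.mul_sum, map_sum]
      refine Finset.sum_congr rfl fun α _ => ?_
      rw [← smul_eq_mul (c α), ← map_smul, mul_smul_comm]
    have hz0 : π f • z = 0 := by
      funext i
      refine hφ _ fun e => ?_
      obtain ⟨g, rfl⟩ := hπ e
      obtain ⟨G, hG⟩ := exists_represents hX g
      have h2 := hF hG (hzγ.smul (π f))
      rw [hzφ, Matrix.mulVec_zero] at h2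
      exact (congrFun h2 i).symm
    have hz1 : z = 0 := by
      have hf0 : π f ≠ 0 := fun h => hfZ ((hπ0 f).mp h)
      funext i
      exact (mul_eq_zero.mp (congrFun hz0 i)).resolve_left hf0
    -- Independence of `a` over the small ring and of `κ` over `R` combine as in the tower law.
    exact Fintype.linearIndependent_iff.mp (linearIndependent_smul ha hκ) c hz1

theorem exists_family {d k n : ℕ} {γ : Tensor d k n} {Z : Set (PP d)}
    {ℓ : Fin (k + 1) → MvPolynomial (Fin (d + 1)) ℂ}
    {X : Fin (d + 1) → Matrix (Fin n) (Fin n) (MvPolynomial (Fin (k + 1)) ℂ)}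
    (hℓ1 : ∀ l, (ℓ l).IsHomogeneous 1) (hX : ActsByCoordinates γ ℓ X) (hZ : Z ⊆ locus γ)
    (hZirr : IsIrreducible Z) (hZk : dim Z = k) :
    ∃ r : ℕ, varDegree k Z = r ∧
      ∃ w : Fin r × Fin (genericKernelDim γ Z) → Fin n → MvPolynomial (Fin (k + 1)) ℂ,
        ∀ f F, Represents γ ℓ F f → (f ∈ homIdeal Z → ∀ α, F.mulVec (w α) = 0) ∧
          (f ∉ homIdeal Z →
            LinearIndependent (MvPolynomial (Fin (k + 1)) ℂ) fun α => F.mulVec (w α)) := by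
  have hprime := homIdeal_isPrime hZirr
  have hdom : IsDomain (CoordRing Z) := Ideal.Quotient.isDomain (homIdeal Z)
  obtain ⟨κ, hκ, hκγ⟩ := exists_linearIndependent_annihilates γ hprime
  let ψ : MvPolynomial (Fin (k + 1)) ℂ →ₐ[ℂ] CoordRing Z :=
    (Ideal.Quotient.mkₐ ℂ (homIdeal Z)).comp (MvPolynomial.aeval ℓ)
  let A : Algebra (MvPolynomial (Fin (k + 1)) ℂ) (CoordRing Z) := ψ.toRingHom.toAlgebra
  have htower : @IsScalarTower ℂ (MvPolynomial (Fin (k + 1)) ℂ) (CoordRing Z) _ A.toSMul _ :=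
    IsScalarTower.of_algebraMap_eq fun c => (ψ.commutes c).symm
  obtain ⟨r, hr, w, hw⟩ := @exists_family_of_quotient d k n _ (CoordRing Z) _ hdom _ A htower
    (Ideal.Quotient.mkₐ ℂ (homIdeal Z)) γ Z ℓ X (Ideal.Quotient.mkₐ_surjective ℂ (homIdeal Z))
    (fun f => Ideal.Quotient.eq_zero_iff_mem) (fun p => rfl) hℓ1 hX hZ
    (add_one_le_ringKrullDim_coordRing hZk) κ hκ hκγ
  -- `varDegree` is a `limUnder`, so the proven convergence determines it.
  exact ⟨r, hr.limUnder_eq, w, hw⟩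

/-! ### Components -/

theorem component_properties {d : ℕ} {Y Z : Set (PP d)} (hZ : Z ∈ components Y) :
    Z ⊆ Y ∧ IsIrreducible Z ∧ (∀ Z' ⊆ Y, IsIrreducible Z' → Z ⊆ Z' → Z' = Z) ∧
      ∀ p ∈ Y, p ∉ Z → ∃ f ∈ homIdeal Z, MvPolynomial.eval (Projectivization.rep p) f ≠ 0 := by
  obtain ⟨s, hs, rfl⟩ := hZ
  refine ⟨?_, hs.1.image _ continuous_subtype_val.continuousOn, ?_, ?_⟩
  · rintro _ ⟨x, -, rfl⟩
    exact x.2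
  · intro Z' hZ' hirr hsZ'
    have h1 : Subtype.val '' (Subtype.val ⁻¹' Z' : Set Y) = Z' := by
      rw [Subtype.image_preimage_coe, Set.inter_eq_right.mpr hZ']
    have h2 : IsIrreducible (Subtype.val ⁻¹' Z' : Set Y) := by
      have := Subtype.irreducibleSpace hirr
      have h4 : (Subtype.val ⁻¹' Z' : Set Y) = Set.inclusion hZ' '' Set.univ := by
        ext x
        simp
      rw [h4]
      exact (IrreducibleSpace.isIrreducible_univ Z').image _
        (continuous_inclusion hZ').continuousOn
    have h3 : s ≤ (Subtype.val ⁻¹' Z' : Set Y) := fun x hx => hsZ' ⟨x, hx, rfl⟩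
    rw [← h1, (hs.2 h2 h3).antisymm h3]
  · intro p hpY hp
    obtain ⟨C, hC, hCs⟩ := isClosed_induced_iff.mp (isClosed_of_mem_irreducibleComponents s hs)
    have hpC : p ∉ C := fun h => hp ⟨⟨p, hpY⟩, by rw [← hCs]; exact h, rfl⟩
    obtain ⟨f, hf, -, -, hfp⟩ := exists_isHomogeneous_of_notMem hC hpC
    refine ⟨f, homIdeal_anti ?_ hf, hfp⟩
    rintro _ ⟨x, hx, rfl⟩
    rw [← hCs] at hx
    exact hx

/-- By maximality of `Z` no other component contains it, so each `Z'` has an equation not vanishing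
on all of `Z`. The product of these works because `homIdeal Z` is prime. -/
theorem exists_notMem_homIdeal {d : ℕ} {Y Z : Set (PP d)} (hZ : Z ∈ components Y)
    (T : Finset (Set (PP d))) (hT : ∀ Z' ∈ T, Z' ∈ components Y ∧ Z' ≠ Z) :
    ∃ f, f ∉ homIdeal Z ∧ ∀ Z' ∈ T, f ∈ homIdeal Z' := by
  obtain ⟨hZY, hZirr, hZmax, -⟩ := component_properties hZ
  have := homIdeal_isPrime hZirr
  have h1 : ∀ Z' ∈ T, ∃ f ∈ homIdeal Z', f ∉ homIdeal Z := by
    intro Z' hZ'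
    obtain ⟨hZ'Y, hne⟩ := hT Z' hZ'
    obtain ⟨hZ'sub, hZ'irr, -, hZ'sep⟩ := component_properties hZ'Y
    obtain ⟨p, hpZ, hpZ'⟩ := Set.not_subset.mp fun h => hne (hZmax Z' hZ'sub hZ'irr h)
    obtain ⟨f, hf, hfp⟩ := hZ'sep p (hZY hpZ) hpZ'
    exact ⟨f, hf, fun h => hfp (by simpa using mem_homIdeal.mp h p hpZ 1)⟩
  choose! f hf hf' using h1
  refine ⟨∏ Z' ∈ T, f Z', fun h => ?_, fun Z' hZ' =>
    Ideal.mem_of_dvd _ (Finset.dvd_prod_of_mem f hZ') (hf Z' hZ')⟩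
  obtain ⟨Z', hZ', h⟩ := (Ideal.IsPrime.prod_mem_iff).mp h
  exact hf' Z' hZ' h

/-! ### Combining the components and comparing with the rank `n` -/

theorem matrix_eq_zero_of_linearIndependent {S ι : Type} [CommRing S] [IsDomain S] [Fintype ι]
    {n : ℕ} (hι : Fintype.card ι = n) {w : ι → Fin n → S} (hw : LinearIndependent S w)
    {F : Matrix (Fin n) (Fin n) S} (hF : ∀ i, F.mulVec (w i) = 0) : F = 0 := by
  let e : Fin n ≃ ι := (Fintype.equivFinOfCardEq hι).symm
  let W : Matrix (Fin n) (Fin n) S := Matrix.of fun i => w (e i)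
  have hdet : W.det ≠ 0 := by
    rw [Ne, ← Matrix.exists_vecMul_eq_zero_iff]
    rintro ⟨c, hc, hcW⟩
    refine hc (funext (Fintype.linearIndependent_iff.mp (hw.comp e e.injective) c ?_))
    rw [← hcW]
    ext j
    simp [W, Matrix.vecMul, dotProduct]
  have h1 : F * W.transpose = 0 := by
    ext i j
    exact congrFun (hF (e j)) i
  have h2 : W.det • F = 0 := by
    have := congrArg (· * W.transpose.adjugate) h1
    simpa [Matrix.mul_assoc, Matrix.mul_adjugate] using this
  ext i j
  exact (mul_eq_zero.mp (congrFun (congrFun h2 i) j)).resolve_left hdet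

theorem sum_le_and_mem_of_sum_eq {d k n : ℕ} (hk : k ≤ d) {γ : Tensor d k n}
    (hγ : IsNondegenerate γ) (T : Finset (Set (PP d)))
    (hT : ∀ Z ∈ T, Z ∈ components (locus γ) ∧ dim Z = k) :
    ∑ Z ∈ T, (genericKernelDim γ Z : ℝ) * varDegree k Z ≤ n ∧
      (∑ Z ∈ T, (genericKernelDim γ Z : ℝ) * varDegree k Z = n →
        ∀ Z ∈ components (locus γ), Z ∈ T) := by
  classical
  obtain ⟨ℓ, X, hℓ1, hX⟩ := exists_actsByCoordinates hk hγ
  have hfam : ∀ Z : T, _ := fun Z =>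
    exists_family hℓ1 hX (component_properties (hT Z Z.2).1).1
      (component_properties (hT Z Z.2).1).2.1 (hT Z Z.2).2
  choose r hr w hw using hfam
  let u : (Σ Z : T, Fin (r Z) × Fin (genericKernelDim γ (Z : Set (PP d)))) →
      Fin n → MvPolynomial (Fin (k + 1)) ℂ := fun x => w x.1 x.2
  have hu : LinearIndependent (MvPolynomial (Fin (k + 1)) ℂ) u := by
    rw [Fintype.linearIndependent_iff]
    rintro c hc ⟨Z, α⟩
    -- The matrix of such an `f` kills the families of the other components and keeps that of `Z`
    -- independent, isolating the coefficients at `Z`.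
    obtain ⟨f, hfZ, hf⟩ := exists_notMem_homIdeal (hT Z Z.2).1 (T.erase Z) fun Z' hZ' =>
      ⟨(hT Z' (Finset.mem_of_mem_erase hZ')).1, Finset.ne_of_mem_erase hZ'⟩
    obtain ⟨F, hF⟩ := exists_represents hX f
    refine Fintype.linearIndependent_iff.mp ((hw Z f F hF).2 hfZ) (fun α => c ⟨Z, α⟩) ?_ α
    have h1 := congrArg F.mulVec hc
    rw [Fintype.sum_sigma, Matrix.mulVec_sum, Matrix.mulVec_zero, Finset.sum_eq_single Z] at h1
    · rw [Matrix.mulVec_sum] at h1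
      simpa only [Matrix.mulVec_smul] using h1
    · intro Z' _ hZ'
      rw [Matrix.mulVec_sum]
      refine Finset.sum_eq_zero fun β _ => ?_
      rw [Matrix.mulVec_smul, (hw Z' f F hF).1 (hf Z' (Finset.mem_erase.mpr
        ⟨fun h => hZ' (Subtype.ext h), Z'.2⟩)) β, smul_zero]
    · simp
  have hcard : ∑ Z ∈ T, (genericKernelDim γ Z : ℝ) * varDegree k Z =
      (Fintype.card (Σ Z : T, Fin (r Z) × Fin (genericKernelDim γ (Z : Set (PP d)))) : ℕ) := by
    rw [Fintype.card_sigma, ← Finset.sum_coe_sort]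
    push_cast
    refine Finset.sum_congr rfl fun Z _ => ?_
    rw [hr]
    simp [mul_comm]
  rw [hcard]
  refine ⟨?_, fun hn Z hZ => ?_⟩
  · have := hu.fintype_card_le_finrank
    rw [Module.finrank_fin_fun] at this
    exact_mod_cast this
  · by_contra hZT
    obtain ⟨f, hfZ, hf⟩ := exists_notMem_homIdeal hZ T fun Z' hZ' =>
      ⟨(hT Z' hZ').1, fun h => hZT (h ▸ hZ')⟩
    obtain ⟨F, hF⟩ := exists_represents hX f
    -- Equality makes `u` a family of `n` independent vectors, all killed by `F`. Then `f` acts as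
    -- zero on the kernel vectors over `Z`, so it vanishes on `Z`.
    have hF0 : F = 0 := matrix_eq_zero_of_linearIndependent (by exact_mod_cast hn) hu
      fun x => (hw x.1 f F hF).1 (hf x.1 x.1.2) x.2
    refine hfZ (mem_homIdeal.mpr fun p hp c => ?_)
    obtain ⟨v, hv, hvp⟩ := exists_annihilates_of_mem_locus ((component_properties hZ).1 hp)
    have h1 := hF ℂ _ v (hvp c)
    rw [hF0, Matrix.map_zero _ (map_zero _), Matrix.zero_mulVec, MvPolynomial.aeval_eq_eval] at h1
    exact (smul_eq_zero.mp h1.symm).resolve_right hv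

end Livsic

end

theorem mainTheorem11 {d k n : ℕ} (hk : k ≤ d) (γ : Livsic.Tensor d k n)
    (hγ : Livsic.IsNondegenerate γ) :
    Livsic.degree γ ≤ (n : ℝ) ∧
      (Livsic.IsVeryReasonable γ → Livsic.HasPureDim (Livsic.locus γ) k) := by
  set f : Set (Livsic.PP d) → ℝ := fun Z =>
    (Livsic.genericKernelDim γ Z : ℝ) * Livsic.varDegree k Z with hf
  set T := {Z ∈ Livsic.components (Livsic.locus γ) | Livsic.dim Z = k} with hT
  have hdeg : Livsic.degree γ = ∑ᶠ Z ∈ T, f Z := rfl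
  rw [Livsic.IsVeryReasonable, hdeg]
  -- Splitting on finiteness makes a proof that there are finitely many components unnecessary. In
  -- the finite case components with zero contribution are dropped, which leaves the sum unchanged.
  by_cases hfin : (T ∩ Function.support f).Finite
  · rw [finsum_mem_eq_sum f hfin]
    have hmem : ∀ Z ∈ hfin.toFinset,
        Z ∈ Livsic.components (Livsic.locus γ) ∧ Livsic.dim Z = k :=
      fun Z hZ => ((Set.Finite.mem_toFinset hfin).mp hZ).1
    obtain ⟨h1, h2⟩ := Livsic.sum_le_and_mem_of_sum_eq hk hγ hfin.toFinset hmem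
    exact ⟨h1, fun hn Z hZ => (hmem Z (h2 hn Z hZ)).2⟩
  -- Here the `finsum` takes its default value `0`. Equality then forces `n = 0`, so there are no
  -- nonzero vectors and the locus is empty, contradicting the existence of the component `Z`.
  · rw [finsum_mem_eq_zero_of_infinite hfin]
    refine ⟨Nat.cast_nonneg n, fun hn Z hZ => ?_⟩
    obtain ⟨p, hp⟩ := (Livsic.component_properties hZ).2.1.nonempty
    obtain ⟨v, hv, -⟩ := (Livsic.component_properties hZ).1 hp
    obtain rfl : n = 0 := by exact_mod_cast hn.symm
    exact absurd (Subsingleton.elim v 0) hv
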